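/- Theorem 1.4. For $n\ge 1$ let $\nu_n$ be a probability distribution on $\mathbb{R}^n$ that is invariant under rotations (orthogonal transformations) and satisfies $\nu_n(\{0\})=0$. Assume that there are a deterministic sequence of nonzero reals $(a_n)_{n\ge1}$ and constants $d_1,d_2,\alpha>0$, $\rho_0\in(0,1)$ such that for every $n\ge1$ and every $\rho\in(0,\rho_0)$ $$\nu_n\left(\left\{x:\left|\frac{\|x\|^2}{a_n}-1\right|\ge\rho\right\}\right)\le d_1e^{-n d_2\rho^\alpha}.$$ Let $0\le g(n)\le n$ be integers (for constant $g$ consider $n\ge g$), and for each $n$ let $b_1^{(n)},\dots,b_{n-g(n)}^{(n)}$ be independent random vectors of $\mathbb{R}^n$ with common distribution $\nu_n$. Write $p=n-g(n)$, and let $\widehat b_1^{(n)},\dots,\widehat b_p^{(n)}$ be the (non-normalized) Gram--Schmidt orthogonalization of $b_1^{(n)},\dots,b_p^{(n)}$. For $s\in(0,1)$ the system is called $s$-reduced if it is linearly independent and $\|\widehat b_{i+1}^{(n)}\|^2/\|\widehat b_i^{(n)}\|^2>s^2$ for all $1\le i\le p-1$. If $p\ge2$, put $$\mathcal{M}_n^g=\min_{1\le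 i\le p-1}\frac{\|\widehat b_{i+1}^{(n)}\|^2}{\|\widehat b_i^{(n)}\|^2},\qquad \mathcal{I}_n^g=\min\left\{i : \frac{\|\widehat b_{n-i}^{(n)}\|^2}{\|\widehat b_{n-i-1}^{(n)}\|^2}=\mathcal{M}_n^g\right\},$$ where $i$ in the second formula ranges over $g\le i\le n-2$ (for $p\le1$ put $\mathcal{I}_n^g=0$). Let $s\in(0,1)$. (i) If $g(n)\to\infty$, then the probability that $(b_1^{(n)},\dots,b_{n-g(n)}^{(n)})$ is $s$-reduced tends to $1$ as $n\to\infty$. (ii) If $g(n)=g$ is constant, then the probability that $(b_1^{(n)},\dots,b_{n-g}^{(n)})$ is $s$-reduced converges, as $n\to\infty$, to a constant in $(0,1)$ that depends only on $s$ and $g$. (iii) If $g(n)=g$ is constant, then $\mathcal{I}_n^g$ converges in distribution, as $n\to\infty$, to a probability law on the nonnegative integers that depends only on $g$. -/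

import Mathlib

open Filter Topology MeasureTheory ProbabilityTheory

universe u

/-- A spherical model: for each dimension `n ≥ 1`, a probability distribution `ν n` on `ℝⁿ`
which is invariant under rotations (all linear isometries of `ℝⁿ`, i.e. the orthogonal group)
and does not charge the origin. -/
structure IsSphericalModel (ν : (n : ℕ) → Measure (EuclideanSpace ℝ (Fin n))) : Prop where
  isProbabilityMeasure : ∀ n, 1 ≤ n → IsProbabilityMeasure (ν n)
  map_rotation : ∀ n, 1 ≤ n →
    ∀ f : EuclideanSpace ℝ (Fin n) ≃ₗᵢ[ℝ] EuclideanSpace ℝ (Fin n), (ν n).map f = ν n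
  zero : ∀ n, 1 ≤ n → ν n {0} = 0

/-- The concentration assumption on the squared norm of a vector with distribution `ν n`. -/
def RadialConcentration (ν : (n : ℕ) → Measure (EuclideanSpace ℝ (Fin n))) : Prop :=
  ∃ (a : ℕ → ℝ) (d₁ d₂ α ρ₀ : ℝ), (∀ n, 1 ≤ n → a n ≠ 0) ∧
    0 < d₁ ∧ 0 < d₂ ∧ 0 < α ∧ ρ₀ ∈ Set.Ioo (0 : ℝ) 1 ∧
    ∀ n, 1 ≤ n → ∀ ρ ∈ Set.Ioo (0 : ℝ) ρ₀,
      (ν n).real {x | ρ ≤ |‖x‖ ^ 2 / a n - 1|} ≤ d₁ * Real.exp (-(n * d₂ * ρ ^ α))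

/-- `b 0, …, b (p - 1)` are independent random vectors with common distribution `ν`. -/
structure IsRandomBasis {n p : ℕ} {Ω : Type*} [MeasurableSpace Ω] (P : Measure Ω)
    (ν : Measure (EuclideanSpace ℝ (Fin n))) (b : Fin p → Ω → EuclideanSpace ℝ (Fin n)) :
    Prop where
  indep : iIndepFun b P
  hasLaw : ∀ i, HasLaw (b i) ν P

/-- The ratio `‖b̂_{j+2}‖² / ‖b̂_{j+1}‖²` of squared lengths of consecutive Gram–Schmidt vectors,
where the system is written `b_1, …, b_p` (so that `b_{j+1}` is `b j` in Lean's numbering). -/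
noncomputable def localRatio {n p : ℕ} (b : Fin p → EuclideanSpace ℝ (Fin n))
    (j : Fin (p - 1)) : ℝ :=
  ‖InnerProductSpace.gramSchmidt ℝ b ⟨j + 1, by omega⟩‖ ^ 2 /
    ‖InnerProductSpace.gramSchmidt ℝ b ⟨j, by omega⟩‖ ^ 2

/-- LLL(`s`)-reduced (in the sense of Siegel): the system is linearly independent and all ratios
of squared lengths of consecutive Gram–Schmidt vectors exceed `s²`. -/
def IsSiegelReduced {n p : ℕ} (s : ℝ) (b : Fin p → EuclideanSpace ℝ (Fin n)) : Prop :=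
  LinearIndependent ℝ b ∧ ∀ j : Fin (p - 1), s ^ 2 < localRatio b j

/-- The reduction level: the minimum of the `p - 1` local ratios
(a finite infimum; only meaningful for `2 ≤ p`). -/
noncomputable def reductionLevel {n p : ℕ} (b : Fin p → EuclideanSpace ℝ (Fin n)) : ℝ :=
  ⨅ j : Fin (p - 1), localRatio b j

/-- The index of worst local reduction: the least `i` such that
`‖b̂_{n-i}‖² / ‖b̂_{n-i-1}‖²` equals the reduction level. In the zero-based numbering of
`localRatio` this ratio is number `j = n - i - 2`. (Equal to `0` if `p ≤ 1`.) -/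
noncomputable def worstIndex {n p : ℕ} (b : Fin p → EuclideanSpace ℝ (Fin n)) : ℕ :=
  sInf {i : ℕ | ∃ j : Fin (p - 1), (j : ℕ) + i + 2 = n ∧ localRatio b j = reductionLevel b}

/-! The squared Gram–Schmidt lengths of independent standard Gaussian vectors of ℝⁿ are independent
chi-squared variables, the one numbered `j` (from zero) having `n - j` degrees of freedom: it is the
squared norm of a Gaussian vector projected onto the orthogonal complement of the span of the
earlier ones (`measurePreserving_gsNormSq`).

A general spherical model is reduced to this case through directions. The law of `x / ‖x‖` is the
same for every rotation invariant law that does not charge the origin (`map_normalize_eq`), and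
scaling each vector scales its Gram–Schmidt vector by the same factor. Both the model and the
Gaussian therefore differ from the common system of directions only by the factors `‖b j‖ ^ 2`.
Radial concentration is exponential in the dimension, so it survives a union bound over at most `n`
vectors: with high probability all these factors agree up to a ratio close to 1. Hence probabilities
of events on consecutive ratios can be compared with chi-squared ones after relaxing the event
slightly (`eventually_chiSqSeq_le`).

Read from the end, the chi-squared variables of all dimensions are coupled as one independent
sequence `η`, and the local ratios become `η (i + 1) / η (i + 2)` with `n - p ≤ i ≤ n - 2`. Almost
surely these ratios tend to 1, are pairwise distinct, avoid any given constant, and fall below 1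
arbitrarily late. So being reduced is, in the limit, the event that all ratios with `g ≤ i` exceed
`s ^ 2`, and the worst index converges to the position of the unique minimum. When `g` tends to
infinity only ratios close to 1 remain. For fixed `g`, independence and the full support of the
chi-squared laws on the half-line place the limit probability strictly between 0 and 1. -/

/-! ### Gram–Schmidt vectors as orthogonal projections -/

open InnerProductSpace in
lemma gramSchmidt_eq_starProjection {ι E : Type*} [NormedAddCommGroup E] [InnerProductSpace ℝ E]
    [FiniteDimensional ℝ E] [LinearOrder ι] [LocallyFiniteOrderBot ι] [WellFoundedLT ι]
    (f : ι → E) (n : ι) :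
    gramSchmidt ℝ f n = (Submodule.span ℝ (f '' Set.Iio n))ᗮ.starProjection (f n) := by
  symm
  apply Submodule.eq_starProjection_of_mem_orthogonal
  · rw [← span_gramSchmidt_Iio ℝ f n, Submodule.mem_orthogonal]
    intro u hu
    induction hu using Submodule.span_induction with
    | mem x hx =>
      obtain ⟨i, hi, rfl⟩ := hx
      exact gramSchmidt_orthogonal ℝ f (ne_of_lt hi)
    | zero => simp
    | add x y _ _ hx hy => rw [inner_add_left, hx, hy, add_zero]
    | smul a x _ hx => rw [inner_smul_left, hx, mul_zero]
  · rw [Submodule.orthogonal_orthogonal, ← span_gramSchmidt_Iio ℝ f n]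
    have h : f n - gramSchmidt ℝ f n
        = ∑ i ∈ Finset.Iio n, (ℝ ∙ gramSchmidt ℝ f i).starProjection (f n) := by
      rw [gramSchmidt_def ℝ f n]; abel
    rw [h]
    refine Submodule.sum_mem _ fun i hi => ?_
    have h1 := Submodule.starProjection_apply_mem (ℝ ∙ gramSchmidt ℝ f i) (f n)
    refine Submodule.span_mono ?_ h1
    rw [Set.singleton_subset_iff]
    exact ⟨i, Finset.mem_Iio.1 hi, rfl⟩

-- Nonzero scalings leave the spans of initial segments unchanged. This separates the lengths of the
-- vectors from their directions.
open InnerProductSpace in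
lemma gramSchmidt_smul_family {ι E : Type*} [NormedAddCommGroup E] [InnerProductSpace ℝ E]
    [FiniteDimensional ℝ E] [LinearOrder ι] [LocallyFiniteOrderBot ι] [WellFoundedLT ι]
    (f : ι → E) (c : ι → ℝ) (hc : ∀ i, c i ≠ 0) (n : ι) :
    gramSchmidt ℝ (fun i => c i • f i) n = c n • gramSchmidt ℝ f n := by
  rw [gramSchmidt_eq_starProjection, gramSchmidt_eq_starProjection, map_smul]
  have : Submodule.span ℝ ((fun i => c i • f i) '' Set.Iio n)
      = Submodule.span ℝ (f '' Set.Iio n) := by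
    apply le_antisymm
    · rw [Submodule.span_le]
      rintro _ ⟨i, hi, rfl⟩
      exact Submodule.smul_mem _ _ (Submodule.subset_span ⟨i, hi, rfl⟩)
    · rw [Submodule.span_le]
      rintro _ ⟨i, hi, rfl⟩
      have h : f i = (c i)⁻¹ • c i • f i := by rw [inv_smul_smul₀ (hc i)]
      rw [h]
      exact Submodule.smul_mem _ _ (Submodule.subset_span ⟨i, hi, rfl⟩)
  simp only [this]

open InnerProductSpace in
lemma gramSchmidt_snoc_castSucc {E : Type*} [NormedAddCommGroup E] [InnerProductSpace ℝ E]
    [FiniteDimensional ℝ E] {p : ℕ} (y : Fin p → E) (z : E) (j : Fin p) :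
    gramSchmidt ℝ (Fin.snoc y z : Fin (p + 1) → E) j.castSucc = gramSchmidt ℝ y j := by
  rw [gramSchmidt_eq_starProjection, gramSchmidt_eq_starProjection, Fin.snoc_castSucc]
  have : (Fin.snoc y z : Fin (p + 1) → E) '' Set.Iio j.castSucc = y '' Set.Iio j := by
    ext x
    constructor
    · rintro ⟨i, hi, rfl⟩
      induction i using Fin.lastCases with
      | last => exact absurd (Set.mem_Iio.1 hi) (by simp [Fin.lt_def])
      | cast i => exact ⟨i, by simpa using hi, by simp⟩
    · rintro ⟨i, hi, rfl⟩
      exact ⟨i.castSucc, by simpa using hi, by simp⟩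
  simp only [this]

open InnerProductSpace in
lemma gramSchmidt_snoc_last {E : Type*} [NormedAddCommGroup E] [InnerProductSpace ℝ E]
    [FiniteDimensional ℝ E] {p : ℕ} (y : Fin p → E) (z : E) :
    gramSchmidt ℝ (Fin.snoc y z : Fin (p + 1) → E) (Fin.last p)
      = (Submodule.span ℝ (Set.range y))ᗮ.starProjection z := by
  rw [gramSchmidt_eq_starProjection, Fin.snoc_last]
  have : (Fin.snoc y z : Fin (p + 1) → E) '' Set.Iio (Fin.last p) = Set.range y := by
    ext x
    constructor
    · rintro ⟨i, hi, rfl⟩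
      induction i using Fin.lastCases with
      | last => exact absurd (Set.mem_Iio.1 hi) (lt_irrefl _)
      | cast i => exact ⟨i, by simp⟩
    · rintro ⟨i, rfl⟩
      exact ⟨i.castSucc, by simp [Fin.castSucc_lt_last], by simp⟩
  simp only [this]

open InnerProductSpace in
lemma measurable_gramSchmidt {ι E : Type*} [NormedAddCommGroup E] [InnerProductSpace ℝ E]
    [FiniteDimensional ℝ E] [MeasurableSpace E] [BorelSpace E]
    [LinearOrder ι] [LocallyFiniteOrderBot ι] [WellFoundedLT ι] (n : ι) :
    Measurable fun f : ι → E => gramSchmidt ℝ f n := by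
  induction n using WellFoundedLT.induction with
  | ind n ih =>
    have h : (fun f : ι → E => gramSchmidt ℝ f n) = fun f => f n - ∑ i ∈ Finset.Iio n,
        (inner ℝ (gramSchmidt ℝ f i) (f n) / ‖gramSchmidt ℝ f i‖ ^ 2) • gramSchmidt ℝ f i := by
      ext1 f
      rw [gramSchmidt_def ℝ f n]
      simp only [Submodule.starProjection_singleton]
      rfl
    rw [h]
    refine (measurable_pi_apply n).sub (Finset.measurable_sum _ fun i hi => ?_)
    have hi' := ih i (Finset.mem_Iio.1 hi)
    exact ((hi'.inner (measurable_pi_apply n)).div (hi'.norm.pow_const 2)).smul hi'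

open InnerProductSpace in
lemma linearIndependent_of_gramSchmidt_ne_zero {E : Type*} [NormedAddCommGroup E]
    [InnerProductSpace ℝ E] [FiniteDimensional ℝ E] {p : ℕ} (f : Fin p → E)
    (h : ∀ j, gramSchmidt ℝ f j ≠ 0) : LinearIndependent ℝ f := by
  have h1 : LinearIndependent ℝ (gramSchmidt ℝ f) :=
    linearIndependent_of_ne_zero_of_inner_eq_zero h (gramSchmidt_pairwise_orthogonal ℝ f)
  rw [linearIndependent_iff_card_eq_finrank_span] at h1 ⊢
  rw [h1, Set.finrank, Set.finrank, span_gramSchmidt]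

/-! ### Gram–Schmidt lengths of Gaussian vectors -/

/-- The chi-squared distribution with `k` degrees of freedom: the law of the squared norm of a
standard Gaussian vector of `ℝᵏ`. -/
noncomputable def chiSq (k : ℕ) : Measure ℝ :=
  (stdGaussian (EuclideanSpace ℝ (Fin k))).map fun x => ‖x‖ ^ 2

instance isProbabilityMeasure_chiSq (k : ℕ) : IsProbabilityMeasure (chiSq k) :=
  Measure.isProbabilityMeasure_map (by fun_prop)

section

variable {E : Type*} [NormedAddCommGroup E] [InnerProductSpace ℝ E] [FiniteDimensional ℝ E]
  [MeasurableSpace E] [BorelSpace E]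

lemma map_norm_sq_stdGaussian {k : ℕ} (hk : Module.finrank ℝ E = k) :
    (stdGaussian E).map (fun x => ‖x‖ ^ 2) = chiSq k := by
  subst hk
  have h := stdGaussian_map (E := E) (stdOrthonormalBasis ℝ E).repr
  rw [chiSq, ← h, Measure.map_map (by fun_prop)
    (stdOrthonormalBasis ℝ E).repr.continuous.measurable]
  congr 1
  ext x
  simp

lemma map_orthogonalProjectionOnto_stdGaussian (K : Submodule ℝ E) :
    (stdGaussian E).map K.orthogonalProjectionOnto = stdGaussian K := by
  have : IsProbabilityMeasure ((stdGaussian E).map K.orthogonalProjectionOnto) :=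
    Measure.isProbabilityMeasure_map (by fun_prop)
  apply Measure.ext_of_charFun
  ext t
  rw [charFun_stdGaussian, charFun_apply, integral_map (by fun_prop) (by fun_prop)]
  have h := charFun_stdGaussian (E := E) (t : E)
  rw [charFun_apply] at h
  simpa using h

lemma map_norm_sq_starProjection_stdGaussian (K : Submodule ℝ E) {k : ℕ}
    (hk : Module.finrank ℝ K = k) :
    (stdGaussian E).map (fun x => ‖K.starProjection x‖ ^ 2) = chiSq k := by
  rw [← map_norm_sq_stdGaussian (E := K) hk, ← map_orthogonalProjectionOnto_stdGaussian K,
    Measure.map_map (by fun_prop) (by fun_prop)]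
  rfl

end

/-- The vector of the squared norms of the Gram–Schmidt vectors of a system. -/
noncomputable def gsNormSq {n p : ℕ} (b : Fin p → EuclideanSpace ℝ (Fin n)) (j : Fin p) : ℝ :=
  ‖InnerProductSpace.gramSchmidt ℝ b j‖ ^ 2

lemma measurable_gsNormSq {n p : ℕ} :
    Measurable (gsNormSq : (Fin p → EuclideanSpace ℝ (Fin n)) → Fin p → ℝ) :=
  measurable_pi_lambda _ fun j => (measurable_gramSchmidt j).norm.pow_const 2

lemma measurePreserving_snoc {α : Type*} [MeasurableSpace α] (p : ℕ)
    (μ : Fin (p + 1) → Measure α) [∀ i, IsProbabilityMeasure (μ i)] :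
    MeasurePreserving (fun q : (Fin p → α) × α => (Fin.snoc q.1 q.2 : Fin (p + 1) → α))
      ((Measure.pi fun i : Fin p => μ i.castSucc).prod (μ (Fin.last p))) (Measure.pi μ) := by
  have h := (measurePreserving_piFinSuccAbove μ (Fin.last p)).symm.comp
    (Measure.measurePreserving_swap
      (μ := Measure.pi fun i : Fin p => μ ((Fin.last p).succAbove i)) (ν := μ (Fin.last p)))
  simp only [Fin.succAbove_last] at h
  convert! h using 1
  ext q : 1
  simp [MeasurableEquiv.piFinSuccAbove, Fin.insertNthEquiv, Fin.insertNth_last']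

/-- Once all Gaussian coordinates but the last are fixed, the last one can take at most two values;
Fubini concludes. -/
lemma chiSq_singleton {k : ℕ} (hk : 1 ≤ k) (c : ℝ) : chiSq k {c} = 0 := by
  obtain ⟨k, rfl⟩ : ∃ m, k = m + 1 := ⟨k - 1, by omega⟩
  have hm : MeasurableSet {x : Fin (k + 1) → ℝ | ∑ i, x i ^ 2 = c} :=
    measurableSet_eq_fun (by fun_prop) (by fun_prop)
  have h : chiSq (k + 1) {c}
      = Measure.pi (fun _ : Fin (k + 1) => gaussianReal 0 1) {x | ∑ i, x i ^ 2 = c} := by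
    rw [chiSq, ← map_pi_eq_stdGaussian, Measure.map_map (by fun_prop) (by fun_prop),
      Measure.map_apply (by fun_prop) (measurableSet_singleton c)]
    congr 1
    ext x
    simp [EuclideanSpace.norm_sq_eq]
  rw [h, ← (measurePreserving_snoc k fun _ => gaussianReal 0 1).measure_preimage
    hm.nullMeasurableSet, Measure.measure_prod_null
    ((measurePreserving_snoc k fun _ => gaussianReal 0 1).measurable hm)]
  refine ae_of_all _ fun y => ?_
  have hsub : Prod.mk y ⁻¹' ((fun q : (Fin k → ℝ) × ℝ => (Fin.snoc q.1 q.2 : Fin (k + 1) → ℝ)) ⁻¹'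
      {x | ∑ i, x i ^ 2 = c}) ⊆ {√(c - ∑ i, y i ^ 2), -√(c - ∑ i, y i ^ 2)} := by
    intro z hz
    simp only [Set.mem_preimage, Set.mem_ofPred_eq, Fin.sum_univ_castSucc, Fin.snoc_castSucc,
      Fin.snoc_last] at hz
    have hz' : z ^ 2 = c - ∑ i, y i ^ 2 := by linarith
    rw [← hz', Real.sqrt_sq_eq_abs]
    rcases abs_choice z with h | h <;> simp [h]
  have : NullSingletonClass (gaussianReal 0 1) := nullSingletonClass_gaussianReal one_ne_zero
  exact measure_mono_null hsub ((Set.toFinite _).measure_zero _)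

/-- Given the first `p` vectors, the last length is the norm of a Gaussian projected onto a space of
dimension `n - p`. Its conditional law does not depend on these vectors, which gives independence by
a skew product. -/
lemma measurePreserving_gsNormSq (n p : ℕ) (hp : p ≤ n) :
    MeasurePreserving gsNormSq
      (Measure.pi fun _ : Fin p => stdGaussian (EuclideanSpace ℝ (Fin n)))
      (Measure.pi fun j : Fin p => chiSq (n - j)) := by
  induction p with
  | zero =>
    refine ⟨measurable_gsNormSq, ?_⟩
    have : gsNormSq = fun _ : Fin 0 → EuclideanSpace ℝ (Fin n) => (isEmptyElim : Fin 0 → ℝ) :=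
      Subsingleton.elim _ _
    rw [this, Measure.map_const, Measure.pi_of_empty (fun j : Fin 0 => chiSq (n - j))]
    simp
  | succ p ih =>
    have hs1 := measurePreserving_snoc p fun _ => stdGaussian (EuclideanSpace ℝ (Fin n))
    have hs2 := measurePreserving_snoc p fun j : Fin (p + 1) => chiSq (n - j)
    have ih' := ih (by omega)
    simp only [Fin.val_castSucc, Fin.val_last] at hs2
    have hgm : Measurable (Function.uncurry fun (y : Fin p → EuclideanSpace ℝ (Fin n))
        (z : EuclideanSpace ℝ (Fin n)) =>
          ‖(Submodule.span ℝ (Set.range y))ᗮ.starProjection z‖ ^ 2) := by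
      simp only [← gramSchmidt_snoc_last]
      exact ((measurable_gramSchmidt (Fin.last p)).comp hs1.measurable).norm.pow_const 2
    -- By induction the earlier lengths are almost surely nonzero, so the earlier vectors span a
    -- space of dimension exactly `p`.
    have hne : ∀ᵐ y ∂(Measure.pi fun _ : Fin p => stdGaussian (EuclideanSpace ℝ (Fin n))),
        ∀ j, InnerProductSpace.gramSchmidt ℝ y j ≠ 0 := by
      rw [ae_all_iff]
      intro j
      have h0 : Measure.pi (fun j : Fin p => chiSq (n - j)) {x | x j = 0} = 0 := by
        have := (measurePreserving_eval (fun j : Fin p => chiSq (n - j)) j).measure_preimage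
          (measurableSet_singleton (0 : ℝ)).nullMeasurableSet
        rw [chiSq_singleton (by omega)] at this
        exact this
      have h1 := ih'.quasiMeasurePreserving.preimage_null h0
      filter_upwards [compl_mem_ae_iff.2 h1] with y hy hy0
      exact hy (by simp [gsNormSq, hy0])
    have hsk := ih'.skew_product (μc := stdGaussian (EuclideanSpace ℝ (Fin n)))
      (μd := chiSq (n - p)) hgm (by
        filter_upwards [hne] with y hy
        refine map_norm_sq_starProjection_stdGaussian _ ?_
        have hli := linearIndependent_of_gramSchmidt_ne_zero y hy
        have h1 := finrank_span_eq_card hli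
        have h2 := (Submodule.span ℝ (Set.range y)).finrank_add_finrank_orthogonal
        rw [h1, finrank_euclideanSpace, Fintype.card_fin, Fintype.card_fin] at h2
        omega)
    have hcomp := hs2.comp hsk
    refine ⟨measurable_gsNormSq, ?_⟩
    rw [← hcomp.map_eq, ← hs1.map_eq, Measure.map_map measurable_gsNormSq hs1.measurable]
    congr 1
    ext q j
    induction j using Fin.lastCases with
    | last => simp [gsNormSq, gramSchmidt_snoc_last]
    | cast j => simp [gsNormSq, gramSchmidt_snoc_castSucc]

/-! ### Support and concentration of the chi-squared laws -/

instance isOpenPosMeasure_gaussianReal : (gaussianReal 0 1).IsOpenPosMeasure :=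
  (gaussianReal_absolutelyContinuous' 0 one_ne_zero).isOpenPosMeasure

instance isOpenPosMeasure_stdGaussian (k : ℕ) :
    (stdGaussian (EuclideanSpace ℝ (Fin k))).IsOpenPosMeasure := by
  rw [← map_pi_eq_stdGaussian]
  exact Continuous.isOpenPosMeasure_map (by fun_prop) (WithLp.toLp_surjective 2)

lemma chiSq_pos_of_isOpen {k : ℕ} (hk : 1 ≤ k) {U : Set ℝ} (hU : IsOpen U) {x : ℝ} (hx : 0 ≤ x)
    (hxU : x ∈ U) : 0 < chiSq k U := by
  rw [chiSq, Measure.map_apply (by fun_prop) hU.measurableSet]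
  refine (hU.preimage (by fun_prop)).measure_pos _ ⟨√x • EuclideanSpace.single ⟨0, hk⟩ 1, ?_⟩
  simpa [norm_smul, Real.sq_sqrt hx] using hxU

lemma ae_chiSq_pos {k : ℕ} (hk : 1 ≤ k) : ∀ᵐ x ∂(chiSq k), 0 < x := by
  have h1 : ∀ᵐ x ∂(chiSq k), 0 ≤ x := by
    rw [chiSq, ae_map_iff (by fun_prop) measurableSet_Ici]
    exact ae_of_all _ fun x => sq_nonneg _
  have h2 : ∀ᵐ x ∂(chiSq k), x ∉ ({0} : Set ℝ) := measure_eq_zero_iff_ae_notMem.1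
    (chiSq_singleton hk 0)
  filter_upwards [h1, h2] with x h1 h2
  exact lt_of_le_of_ne h1 fun h => h2 h.symm

lemma integrable_exp_mul_sq_gaussianReal {t : ℝ} (ht : t < 1 / 2) :
    Integrable (fun x => Real.exp (t * x ^ 2)) (gaussianReal 0 1) := by
  rw [gaussianReal_of_var_ne_zero 0 one_ne_zero,
    integrable_withDensity_iff (measurable_gaussianPDF 0 1)
      (ae_of_all _ fun x => gaussianPDF_lt_top)]
  have h := (integrable_exp_neg_mul_sq (b := 1 / 2 - t) (by linarith)).const_mul
    (√(2 * Real.pi))⁻¹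
  convert! h using 1
  ext x
  rw [toReal_gaussianPDF, gaussianPDFReal, mul_left_comm, ← Real.exp_add]
  simp only [NNReal.coe_one, mul_one]
  ring_nf

lemma mgf_sq_gaussianReal {t : ℝ} (ht : t < 1 / 2) :
    mgf (fun x => x ^ 2) (gaussianReal 0 1) t = (√(1 - 2 * t))⁻¹ := by
  rw [mgf, integral_gaussianReal_eq_integral_smul one_ne_zero]
  have h : ∀ x : ℝ, gaussianPDFReal 0 1 x • Real.exp (t * x ^ 2)
      = (√(2 * Real.pi))⁻¹ * Real.exp (-(1 / 2 - t) * x ^ 2) := by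
    intro x
    rw [gaussianPDFReal, smul_eq_mul, mul_assoc, ← Real.exp_add]
    simp only [NNReal.coe_one, mul_one]
    ring_nf
  simp only [h]
  rw [integral_const_mul, integral_gaussian]
  have h2 : Real.pi / (1 / 2 - t) = 2 * Real.pi / (1 - 2 * t) := by
    have : 1 / 2 - t ≠ 0 := by linarith
    have : 1 - 2 * t ≠ 0 := by linarith
    field_simp
  rw [h2, Real.sqrt_div (by positivity)]
  have : √(2 * Real.pi) ≠ 0 := by positivity
  field_simp

lemma chiSq_eq_map_pi (k : ℕ) : chiSq k
    = (Measure.pi fun _ : Fin k => gaussianReal 0 1).map (∑ i, fun x : Fin k → ℝ => x i ^ 2) := by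
  rw [chiSq, ← map_pi_eq_stdGaussian, Measure.map_map (by fun_prop) (by fun_prop)]
  congr 1
  ext x
  simp [EuclideanSpace.norm_sq_eq]

lemma integrable_exp_mul_chiSq (k : ℕ) {t : ℝ} (ht : t < 1 / 2) :
    Integrable (fun x => Real.exp (t * x)) (chiSq k) := by
  have hm : Measurable (∑ i, fun x : Fin k → ℝ => x i ^ 2) :=
    Finset.sum_induction _ Measurable (fun _ _ => Measurable.add) measurable_zero
      fun i _ => by fun_prop
  rw [chiSq_eq_map_pi, integrable_map_measure (by fun_prop) hm.aemeasurable]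
  refine iIndepFun.integrable_exp_mul_sum (X := fun i (x : Fin k → ℝ) => x i ^ 2)
    (iIndepFun_pi (X := fun _ (x : ℝ) => x ^ 2) fun i => by fun_prop) (fun i => by fun_prop)
    fun i _ => ?_
  exact (measurePreserving_eval (fun _ : Fin k => gaussianReal 0 1) i).integrable_comp_of_integrable
    (integrable_exp_mul_sq_gaussianReal ht)

lemma mgf_chiSq (k : ℕ) {t : ℝ} (ht : t < 1 / 2) :
    mgf id (chiSq k) t = (√(1 - 2 * t))⁻¹ ^ k := by
  have hm : Measurable (∑ i, fun x : Fin k → ℝ => x i ^ 2) :=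
    Finset.sum_induction _ Measurable (fun _ _ => Measurable.add) measurable_zero
      fun i _ => by fun_prop
  rw [chiSq_eq_map_pi, mgf_id_map hm.aemeasurable,
    iIndepFun.mgf_sum (X := fun i (x : Fin k → ℝ) => x i ^ 2)
      (iIndepFun_pi (X := fun _ (x : ℝ) => x ^ 2) fun i => by fun_prop) (fun i => by fun_prop)]
  have h : ∀ i : Fin k, mgf (fun x : Fin k → ℝ => x i ^ 2)
      (Measure.pi fun _ : Fin k => gaussianReal 0 1) t = (√(1 - 2 * t))⁻¹ := by
    intro i
    have hmp := measurePreserving_eval (fun _ : Fin k => gaussianReal 0 1) i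
    have := mgf_map (X := fun x : ℝ => x ^ 2) (t := t)
      (μ := Measure.pi fun _ : Fin k => gaussianReal 0 1) hmp.measurable.aemeasurable (by fun_prop)
    rw [hmp.map_eq, mgf_sq_gaussianReal ht] at this
    exact this.symm
  simp [h]

/-- The left side is the base of the Chernoff bound for a threshold `r` per degree of freedom.
Squaring turns the claim into `1 < (1 - 2 * t) * exp y`, for which the linear lower bound on `exp y`
suffices. -/
lemma exp_mul_inv_sqrt_lt_one {t r y : ℝ} (hy : 1 + y ≤ Real.exp y) (hty : y = 2 * t * r)
    (h1 : 1 < (1 - 2 * t) * (1 + y)) (ht : t < 1 / 2) :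
    Real.exp (-t * r) * (√(1 - 2 * t))⁻¹ < 1 := by
  have h0 : 0 < 1 - 2 * t := by linarith
  have hs : 0 < √(1 - 2 * t) := Real.sqrt_pos.2 h0
  rw [← div_eq_mul_inv, div_lt_one hs]
  apply Real.lt_sqrt_of_sq_lt
  have h2 : Real.exp (-t * r) ^ 2 = (Real.exp y)⁻¹ := by
    rw [← Real.exp_nat_mul, ← Real.exp_neg, hty]; congr 1; push_cast; ring
  rw [h2]
  have h4 : 1 < (1 - 2 * t) * Real.exp y :=
    h1.trans_le (mul_le_mul_of_nonneg_left hy h0.le)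
  rwa [inv_lt_iff_one_lt_mul₀ (Real.exp_pos y)]

/-- The chi-squared distributions concentrate exponentially fast around their means. -/
lemma exists_chiSq_concentration {ρ : ℝ} (h0 : 0 < ρ) (h1 : ρ < 1) :
    ∃ q : ℝ, 0 ≤ q ∧ q < 1 ∧
      ∀ k : ℕ, (chiSq k).real {x | ρ * k ≤ |x - k|} ≤ 2 * q ^ k := by
  -- With this exponent, `(1 - 2t)(1 + y)` exceeds 1 by `ρ²(3 - ρ)/16` for the upper tail and, with
  -- `-t`, by `ρ²(3 + ρ)/16` for the lower tail.
  set t : ℝ := ρ / 8 with ht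
  set q₁ : ℝ := Real.exp (-t * (1 + ρ)) * (√(1 - 2 * t))⁻¹ with hq₁
  set q₂ : ℝ := Real.exp (-(-t) * (1 - ρ)) * (√(1 - 2 * (-t)))⁻¹ with hq₂
  have hq₁0 : 0 ≤ q₁ := by positivity
  have hq₂0 : 0 ≤ q₂ := by positivity
  have ht' : t < 1 / 2 := by linarith
  have h₁ : q₁ < 1 := by
    refine exp_mul_inv_sqrt_lt_one (y := 2 * t * (1 + ρ)) ?_ rfl ?_ ht'
    · linarith [Real.add_one_le_exp (2 * t * (1 + ρ))]
    · rw [ht]; nlinarith [mul_pos (mul_pos h0 h0) (show 0 < 3 - ρ by linarith)]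
  have h₂ : q₂ < 1 := by
    refine exp_mul_inv_sqrt_lt_one (y := 2 * (-t) * (1 - ρ)) ?_ rfl ?_ (by linarith)
    · linarith [Real.add_one_le_exp (2 * (-t) * (1 - ρ))]
    · rw [ht]; nlinarith [mul_pos (mul_pos h0 h0) (show 0 < 3 + ρ by linarith)]
  refine ⟨max q₁ q₂, le_max_of_le_left hq₁0, max_lt h₁ h₂, fun k => ?_⟩
  have e₁ := measure_ge_le_exp_mul_mgf (μ := chiSq k) (X := id) (t := t) ((1 + ρ) * k)
    (by positivity) (integrable_exp_mul_chiSq k ht')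
  have e₂ := measure_le_le_exp_mul_mgf (μ := chiSq k) (X := id) (t := -t) ((1 - ρ) * k)
    (by linarith) (integrable_exp_mul_chiSq k (by linarith))
  rw [mgf_chiSq k (by linarith), ← mul_assoc, mul_comm (_ * _) (k : ℝ), Real.exp_nat_mul,
    ← mul_pow] at e₁ e₂
  have hsub : {x : ℝ | ρ * k ≤ |x - k|}
      ⊆ {x | (1 + ρ) * k ≤ id x} ∪ {x | id x ≤ (1 - ρ) * k} := by
    intro x hx
    rcases le_abs.1 (show ρ * k ≤ |x - k| from hx) with h | h
    · left; simp only [Set.mem_ofPred_eq, id]; linarith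
    · right; simp only [Set.mem_ofPred_eq, id]; linarith
  calc (chiSq k).real {x | ρ * k ≤ |x - k|}
      ≤ _ := (measureReal_mono hsub).trans (measureReal_union_le _ _)
    _ ≤ q₁ ^ k + q₂ ^ k := add_le_add e₁ e₂
    _ ≤ (max q₁ q₂) ^ k + (max q₁ q₂) ^ k := by
        gcongr
        · exact le_max_left _ _
        · exact le_max_right _ _
    _ = _ := by ring

/-! ### Uniqueness of the law of the direction -/

section

variable {E : Type*} [NormedAddCommGroup E] [InnerProductSpace ℝ E] [FiniteDimensional ℝ E]
  [MeasurableSpace E] [BorelSpace E]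

/-- The reflection in the hyperplane orthogonal to `x - y` exchanges two vectors of equal norm. -/
lemma charFun_eq_of_norm_eq {μ : Measure E} [IsProbabilityMeasure μ]
    (hμ : ∀ f : E ≃ₗᵢ[ℝ] E, μ.map f = μ) {x y : E} (h : ‖x‖ = ‖y‖) :
    charFun μ x = charFun μ y := by
  set f := (Submodule.span ℝ {x - y})ᗮ.reflection with hf
  have hxy : f x = y := Submodule.reflection_sub h
  have h1 : charFun μ y = charFun (μ.map f) y := by rw [hμ f]
  rw [h1, charFun_apply, charFun_apply, integral_map (by fun_prop) (by fun_prop), ← hxy]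
  simp

/-- A rotation invariant probability measure on the unit sphere is unique. -/
lemma eq_of_rotation_invariant {μ ν : Measure E} [IsProbabilityMeasure μ] [IsProbabilityMeasure ν]
    (hμ : ∀ f : E ≃ₗᵢ[ℝ] E, μ.map f = μ) (hν : ∀ f : E ≃ₗᵢ[ℝ] E, ν.map f = ν)
    (hμ1 : ∀ᵐ x ∂μ, ‖x‖ = 1) (hν1 : ∀ᵐ x ∂ν, ‖x‖ = 1) : μ = ν := by
  apply Measure.ext_of_charFun
  ext t
  -- The characteristic function of `μ` depends only on the norm, so its value at `t` can be
  -- averaged over `‖t‖ • y` with `y` of law `ν`. The resulting double integral is symmetric in `μ`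
  -- and `ν`.
  have key : ∀ {μ ν : Measure E} [IsProbabilityMeasure μ] [IsProbabilityMeasure ν],
      (∀ f : E ≃ₗᵢ[ℝ] E, μ.map f = μ) → (∀ᵐ x ∂ν, ‖x‖ = 1) →
      charFun μ t = ∫ y, ∫ x, Complex.exp (↑(‖t‖ * inner ℝ x y) * Complex.I) ∂μ ∂ν := by
    intro μ ν _ _ hμ hν1
    have h : ∀ᵐ y ∂ν, ∫ x, Complex.exp (↑(‖t‖ * inner ℝ x y) * Complex.I) ∂μ = charFun μ t := by
      filter_upwards [hν1] with y hy
      rw [charFun_eq_of_norm_eq hμ (show ‖t‖ = ‖(‖t‖ • y)‖ by simp [norm_smul, hy]), charFun_apply]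
      simp [inner_smul_right]
    rw [integral_congr_ae h]
    simp
  rw [key hμ hν1, key hν hμ1, integral_integral_swap]
  · simp only [real_inner_comm]
  · refine Integrable.of_bound (C := 1) (by fun_prop) (ae_of_all _ fun z => ?_)
    simp [Function.uncurry, Complex.norm_exp]

/-- The direction of a random vector with a rotation invariant distribution which does not charge
the origin has the same law whatever the distribution. -/
lemma map_normalize_eq {μ ν : Measure E} [IsProbabilityMeasure μ] [IsProbabilityMeasure ν]
    (hμ : ∀ f : E ≃ₗᵢ[ℝ] E, μ.map f = μ) (hν : ∀ f : E ≃ₗᵢ[ℝ] E, ν.map f = ν)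
    (hμ0 : μ {0} = 0) (hν0 : ν {0} = 0) :
    μ.map (fun x => ‖x‖⁻¹ • x) = ν.map (fun x => ‖x‖⁻¹ • x) := by
  have hm : Measurable fun x : E => ‖x‖⁻¹ • x := by fun_prop
  have inv : ∀ {μ : Measure E}, (∀ f : E ≃ₗᵢ[ℝ] E, μ.map f = μ) →
      ∀ f : E ≃ₗᵢ[ℝ] E, (μ.map (fun x => ‖x‖⁻¹ • x)).map f = μ.map (fun x => ‖x‖⁻¹ • x) := by
    intro μ hμ f
    conv_rhs => rw [← hμ f]
    rw [Measure.map_map (by fun_prop) hm, Measure.map_map hm (by fun_prop)]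
    congr 1
    ext x
    simp
  have one : ∀ {μ : Measure E}, μ {0} = 0 → ∀ᵐ x ∂(μ.map (fun x => ‖x‖⁻¹ • x)), ‖x‖ = 1 := by
    intro μ h0
    rw [ae_map_iff hm.aemeasurable (measurableSet_eq_fun (by fun_prop) (by fun_prop))]
    filter_upwards [measure_eq_zero_iff_ae_notMem.1 h0] with x hx
    have hx0 : ‖x‖ ≠ 0 := norm_ne_zero_iff.2 hx
    simp [norm_smul, hx0]
  have : IsProbabilityMeasure (μ.map (fun x => ‖x‖⁻¹ • x)) :=
    Measure.isProbabilityMeasure_map hm.aemeasurable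
  have : IsProbabilityMeasure (ν.map (fun x => ‖x‖⁻¹ • x)) :=
    Measure.isProbabilityMeasure_map hm.aemeasurable
  exact eq_of_rotation_invariant (inv hμ) (inv hν) (one hμ0) (one hν0)

end

/-! ### Comparison of a spherical model with the Gaussian one -/

/-- Two vectors of positive reals are proportional up to factors whose ratios are at least `c`. -/
def NearlyProportional {ι : Type*} (c : ℝ) (x y : ι → ℝ) : Prop :=
  ∃ l : ι → ℝ, (∀ i, 0 < l i) ∧ (∀ i j, c * l i ≤ l j) ∧ ∀ i, y i = l i * x i

lemma NearlyProportional.symm {ι : Type*} {c : ℝ} {x y : ι → ℝ} (h : NearlyProportional c x y) :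
    NearlyProportional c y x := by
  obtain ⟨l, h0, h1, h2⟩ := h
  refine ⟨fun i => (l i)⁻¹, fun i => inv_pos.2 (h0 i), fun i j => ?_, fun i => ?_⟩
  · rw [← div_eq_mul_inv, div_le_iff₀ (h0 i), ← div_eq_inv_mul, le_div_iff₀ (h0 j)]
    exact h1 j i
  · rw [h2, inv_mul_cancel_left₀ (h0 i).ne']

lemma nearlyProportional_gsNormSq {n p : ℕ} (b : Fin p → EuclideanSpace ℝ (Fin n)) {a ρ c : ℝ}
    (hc : 0 < c) (hcρ : c * (1 + ρ) ≤ 1 - ρ) (hρ : ρ < 1)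
    (hb : ∀ j, |‖b j‖ ^ 2 / a - 1| < ρ) :
    NearlyProportional c (gsNormSq fun j => ‖b j‖⁻¹ • b j) (gsNormSq b) := by
  have hlt : ∀ j, 1 - ρ < ‖b j‖ ^ 2 / a ∧ ‖b j‖ ^ 2 / a < 1 + ρ := by
    intro j
    have := abs_lt.1 (hb j)
    constructor <;> linarith
  have hb0 : ∀ j, ‖b j‖ ≠ 0 := by
    intro j h0
    have := (hlt j).1
    rw [h0] at this
    norm_num at this
    linarith
  refine ⟨fun j => ‖b j‖ ^ 2, fun j => by have := hb0 j; positivity, fun i j => ?_, fun j => ?_⟩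
  -- The normalizing constant has no prescribed sign, but closeness of `‖b i‖ ^ 2 / a` to 1 forces
  -- it to be positive.
  · have ha : 0 < a := by
      by_contra ha
      have h1 : ‖b i‖ ^ 2 / a ≤ 0 := div_nonpos_of_nonneg_of_nonpos (by positivity) (not_lt.1 ha)
      linarith [(hlt i).1]
    have h1 := (div_lt_iff₀ ha).1 (hlt i).2
    have h2 := (lt_div_iff₀ ha).1 (hlt j).1
    calc c * ‖b i‖ ^ 2 ≤ c * ((1 + ρ) * a) := by gcongr
      _ = c * (1 + ρ) * a := by ring
      _ ≤ (1 - ρ) * a := by gcongr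
      _ ≤ _ := h2.le
  · have := hb0 j
    rw [gsNormSq, gsNormSq, gramSchmidt_smul_family b _ (fun i => inv_ne_zero (hb0 i)), norm_smul,
      norm_inv, norm_norm]
    field_simp

lemma stdGaussian_singleton_zero {n : ℕ} (hn : 1 ≤ n) :
    stdGaussian (EuclideanSpace ℝ (Fin n)) {0} = 0 := by
    have h := chiSq_singleton hn 0
    rw [chiSq, Measure.map_apply (by fun_prop) (measurableSet_singleton _)] at h
    refine measure_mono_null ?_ h
    rintro x rfl
    simp

lemma stdGaussian_real_norm_sq_concentration {n : ℕ} (hn : 1 ≤ n) {ρ : ℝ} :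
    (stdGaussian (EuclideanSpace ℝ (Fin n))).real {x | ρ ≤ |‖x‖ ^ 2 / (n : ℝ) - 1|}
      = (chiSq n).real {x | ρ * n ≤ |x - n|} := by
    rw [chiSq, map_measureReal_apply (by fun_prop)
      (measurableSet_le (by fun_prop) (by fun_prop))]
    congr 1
    ext x
    have hn' : (0 : ℝ) < n := by exact_mod_cast hn
    have : ‖x‖ ^ 2 / (n : ℝ) - 1 = (‖x‖ ^ 2 - n) / n := by field_simp
    simp only [Set.mem_ofPred_eq, Set.mem_preimage]
    rw [this, abs_div, abs_of_pos hn', le_div_iff₀ hn']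

section

variable {n p : ℕ} {ν : Measure (EuclideanSpace ℝ (Fin n))} [IsProbabilityMeasure ν]
  {Ω : Type*} [MeasurableSpace Ω] {P : Measure Ω}
  {X : Ω → Fin p → EuclideanSpace ℝ (Fin n)}

lemma measureReal_exists_le (hX : HasLaw X (Measure.pi fun _ => ν) P)
    {S : Set (EuclideanSpace ℝ (Fin n))} (hS : MeasurableSet S) :
    P.real {ω | ∃ j, X ω j ∈ S} ≤ p * ν.real S := by
  have h : {ω | ∃ j, X ω j ∈ S} = ⋃ j, {ω | X ω j ∈ S} := by ext; simp
  have h1 : ∀ j, P.real {ω | X ω j ∈ S} = ν.real S := by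
    intro j
    have h2 := (measurePreserving_eval (fun _ : Fin p => ν) j).hasLaw.comp hX
    exact h2.measureReal_eq hS
  rw [h]
  refine (measureReal_iUnion_fintype_le _).trans ?_
  simp [h1]

lemma measureReal_normalize_mem (hX : HasLaw X (Measure.pi fun _ => ν) P)
    {A : Set (Fin p → ℝ)} (hA : MeasurableSet A) :
    P.real {ω | gsNormSq (fun j => ‖X ω j‖⁻¹ • X ω j) ∈ A}
      = (Measure.pi fun _ : Fin p => ν.map fun x => ‖x‖⁻¹ • x).real {u | gsNormSq u ∈ A} := by
  have hm : Measurable fun x : EuclideanSpace ℝ (Fin n) => ‖x‖⁻¹ • x := by fun_prop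
  have : IsProbabilityMeasure (ν.map fun x => ‖x‖⁻¹ • x) :=
    Measure.isProbabilityMeasure_map hm.aemeasurable
  have h1 : MeasurePreserving (fun x : EuclideanSpace ℝ (Fin n) => ‖x‖⁻¹ • x) ν
      (ν.map fun x => ‖x‖⁻¹ • x) := ⟨hm, rfl⟩
  have h2 := (measurePreserving_pi (fun _ : Fin p => ν) (fun _ : Fin p => ν.map fun x => ‖x‖⁻¹ • x)
    fun _ => h1).hasLaw.comp hX
  exact h2.measureReal_eq (measurable_gsNormSq hA)

/-- Outside the event that some norm is atypical, the system and its directions have nearly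
proportional Gram–Schmidt lengths; the union bound pays for that event. Both directions of the
comparison are needed, to pass from the Gaussian model to the directions and from there to `ν`. -/
lemma measureReal_gsNormSq_compare [IsProbabilityMeasure P] (hX : HasLaw X (Measure.pi fun _ => ν) P)
    {a ρ c : ℝ} (hc : 0 < c) (hcρ : c * (1 + ρ) ≤ 1 - ρ) (hρ : ρ < 1)
    {A B : Set (Fin p → ℝ)} (hAB : ∀ x y, NearlyProportional c x y → x ∈ A → y ∈ B) :
    (MeasurableSet B → P.real {ω | gsNormSq (X ω) ∈ A}
      ≤ (Measure.pi fun _ : Fin p => ν.map fun x => ‖x‖⁻¹ • x).real {u | gsNormSq u ∈ B}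
        + p * ν.real {x | ρ ≤ |‖x‖ ^ 2 / a - 1|}) ∧
    (MeasurableSet A → (Measure.pi fun _ : Fin p => ν.map fun x => ‖x‖⁻¹ • x).real
        {u | gsNormSq u ∈ A}
      ≤ P.real {ω | gsNormSq (X ω) ∈ B} + p * ν.real {x | ρ ≤ |‖x‖ ^ 2 / a - 1|}) := by
  have hbad := measureReal_exists_le hX (S := {x | ρ ≤ |‖x‖ ^ 2 / a - 1|})
    (measurableSet_le (by fun_prop) (by fun_prop))
  have hclose : ∀ ω, ω ∉ {ω | ∃ j, X ω j ∈ {x | ρ ≤ |‖x‖ ^ 2 / a - 1|}} →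
      NearlyProportional c (gsNormSq fun j => ‖X ω j‖⁻¹ • X ω j) (gsNormSq (X ω)) := by
    intro ω hω
    refine nearlyProportional_gsNormSq _ (a := a) hc hcρ hρ fun j => ?_
    by_contra h
    exact hω ⟨j, not_lt.1 h⟩
  constructor
  · intro hB
    rw [← measureReal_normalize_mem hX hB]
    refine le_trans (le_trans (measureReal_mono ?_) (measureReal_union_le _ _))
      (add_le_add_right hbad _)
    intro ω hω
    by_cases h : ω ∈ {ω | ∃ j, X ω j ∈ {x | ρ ≤ |‖x‖ ^ 2 / a - 1|}}
    · exact Or.inr h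
    · exact Or.inl (hAB _ _ (hclose ω h).symm hω)
  · intro hA
    rw [← measureReal_normalize_mem hX hA]
    refine le_trans (le_trans (measureReal_mono ?_) (measureReal_union_le _ _))
      (add_le_add_right hbad _)
    intro ω hω
    by_cases h : ω ∈ {ω | ∃ j, X ω j ∈ {x | ρ ≤ |‖x‖ ^ 2 / a - 1|}}
    · exact Or.inr h
    · exact Or.inl (hAB _ _ (hclose ω h) hω)

/-- Comparison of the Gram–Schmidt norms of a random basis of a spherical model with independent
chi-squared variables. -/
lemma pi_chiSq_le_measureReal_gsNormSq [IsProbabilityMeasure P] (hn : 1 ≤ n) (hp : p ≤ n)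
    (hrot : ∀ f : EuclideanSpace ℝ (Fin n) ≃ₗᵢ[ℝ] EuclideanSpace ℝ (Fin n), ν.map f = ν)
    (h0 : ν {0} = 0) (hX : HasLaw X (Measure.pi fun _ => ν) P)
    {a ρ c : ℝ} (hc : 0 < c) (hcρ : c * (1 + ρ) ≤ 1 - ρ) (hρ : ρ < 1)
    {A A' A'' : Set (Fin p → ℝ)} (hA : MeasurableSet A) (hA' : MeasurableSet A')
    (h₁ : ∀ x y, NearlyProportional c x y → x ∈ A → y ∈ A')
    (h₂ : ∀ x y, NearlyProportional c x y → x ∈ A' → y ∈ A'') :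
    (Measure.pi fun j : Fin p => chiSq (n - j)).real A
      ≤ P.real {ω | gsNormSq (X ω) ∈ A''} + p * ν.real {x | ρ ≤ |‖x‖ ^ 2 / a - 1|}
        + p * (chiSq n).real {x | ρ * n ≤ |x - n|} := by
  have hG : HasLaw (fun x => x : (Fin p → EuclideanSpace ℝ (Fin n)) → _)
      (Measure.pi fun _ => stdGaussian (EuclideanSpace ℝ (Fin n)))
      (Measure.pi fun _ => stdGaussian (EuclideanSpace ℝ (Fin n))) :=
    (MeasurePreserving.id _).hasLaw
  have hdir : (stdGaussian (EuclideanSpace ℝ (Fin n))).map (fun x => ‖x‖⁻¹ • x)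
      = ν.map fun x => ‖x‖⁻¹ • x :=
    map_normalize_eq (fun f => stdGaussian_map f) hrot (stdGaussian_singleton_zero hn) h0
  have e₁ := (measureReal_gsNormSq_compare hG (a := n) hc hcρ hρ h₁).1 hA'
  rw [hdir, stdGaussian_real_norm_sq_concentration hn] at e₁
  have e₂ := (measureReal_gsNormSq_compare hX (a := a) hc hcρ hρ h₂).2 hA'
  have e₃ : (Measure.pi fun _ : Fin p => stdGaussian (EuclideanSpace ℝ (Fin n))).real
      {x | gsNormSq x ∈ A} = (Measure.pi fun j : Fin p => chiSq (n - j)).real A :=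
    (measurePreserving_gsNormSq n p hp).hasLaw.measureReal_eq (p := (· ∈ A)) hA
  rw [← e₃]
  calc _ ≤ _ := e₁
    _ ≤ _ := add_le_add_left e₂ _

end

/-! ### A single chi-squared sequence for all dimensions -/

/-- The law of a sequence `η` of independent random variables where `η k` has the chi-squared
distribution with `k` degrees of freedom. -/
noncomputable def chiSqSeq : Measure (ℕ → ℝ) := Measure.infinitePi chiSq

instance : IsProbabilityMeasure chiSqSeq := by unfold chiSqSeq; infer_instance

lemma iIndepFun_chiSqSeq : iIndepFun (fun k (η : ℕ → ℝ) => η k) chiSqSeq :=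
  iIndepFun_infinitePi (X := fun _ x => x) fun _ => measurable_id

lemma hasLaw_chiSqSeq (k : ℕ) : HasLaw (fun η : ℕ → ℝ => η k) (chiSq k) chiSqSeq :=
  (measurePreserving_eval_infinitePi chiSq k).hasLaw

/-- Indexing by degrees of freedom reverses the order of the basis, so the last vectors, which
matter in the limit, keep a fixed place as `n` grows. -/
lemma hasLaw_chiSqSeq_rev (n p : ℕ) (hp : p ≤ n) :
    HasLaw (fun (η : ℕ → ℝ) (j : Fin p) => η (n - j))
      (Measure.pi fun j : Fin p => chiSq (n - j)) chiSqSeq :=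
  iIndepFun.hasLaw_pi (fun j => hasLaw_chiSqSeq (n - j))
    (iIndepFun_chiSqSeq.precomp (g := fun j : Fin p => n - (j : ℕ)) fun i j h => by
      ext; simp only at h; omega)

/-- This is the transfer principle. The set is relaxed twice, from the Gaussian system to the
directions (`A` to `A'`) and from these to the model (`A'` to `A''`). One threshold for `n` serves
every `p`, every basis and all sets. Only a lower bound is stated; upper bounds come from
complementary events. -/
lemma eventually_chiSqSeq_le {ν : (n : ℕ) → Measure (EuclideanSpace ℝ (Fin n))}
    (hν : IsSphericalModel ν) (hconc : RadialConcentration ν) {c δ : ℝ} (hc : 0 < c) (hc1 : c < 1)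
    (hδ : 0 < δ) :
    ∀ᶠ n : ℕ in atTop, ∀ p ≤ n, ∀ (Ω : Type u) [MeasurableSpace Ω] (P : Measure Ω)
      [IsProbabilityMeasure P] (b : Fin p → Ω → EuclideanSpace ℝ (Fin n)),
      IsRandomBasis P (ν n) b → ∀ A A' A'' : Set (Fin p → ℝ), MeasurableSet A →
      MeasurableSet A' → (∀ x y, NearlyProportional c x y → x ∈ A → y ∈ A') →
      (∀ x y, NearlyProportional c x y → x ∈ A' → y ∈ A'') →
      chiSqSeq.real {η | (fun j : Fin p => η (n - j)) ∈ A}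
        ≤ P.real {ω | gsNormSq (fun i => b i ω) ∈ A''} + δ := by
  obtain ⟨a, d₁, d₂, α, ρ₀, -, hd₁, hd₂, -, hρ₀, hconc⟩ := hconc
  -- The first bound gives access to the concentration hypothesis, the second gives `c * (1 + ρ) ≤ 1
  -- - ρ`.
  set ρ := min (ρ₀ / 2) ((1 - c) / 2) with hρdef
  have hρ0 : 0 < ρ := lt_min (by linarith [hρ₀.1]) (by linarith)
  have hρρ₀ : ρ < ρ₀ := (min_le_left _ _).trans_lt (by linarith [hρ₀.1])
  have hρ1 : ρ < 1 := hρρ₀.trans hρ₀.2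
  have hcρ : c * (1 + ρ) ≤ 1 - ρ := by
    have : ρ ≤ (1 - c) / 2 := min_le_right _ _
    nlinarith
  obtain ⟨q, hq0, hq1, hq⟩ := exists_chiSq_concentration hρ0 hρ1
  set r := Real.exp (-(d₂ * ρ ^ α)) with hr
  have hr1 : r < 1 := by
    rw [hr, Real.exp_lt_one_iff]
    have : 0 < d₂ * ρ ^ α := by positivity
    linarith
  have hlim : Tendsto (fun n : ℕ => d₁ * (n * r ^ n) + 2 * (n * q ^ n)) atTop (𝓝 0) := by
    have h1 := (tendsto_self_mul_const_pow_of_lt_one (Real.exp_pos _).le hr1).const_mul d₁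
    have h2 := (tendsto_self_mul_const_pow_of_lt_one hq0 hq1).const_mul 2
    simpa using h1.add h2
  filter_upwards [hlim.eventually (gt_mem_nhds hδ), eventually_ge_atTop 1] with n hn hn1
  intro p hp Ω _ P _ b hb A A' A'' hA hA' h₁ h₂
  have := hν.isProbabilityMeasure n hn1
  have hX := iIndepFun.hasLaw_pi hb.hasLaw hb.indep
  have key := pi_chiSq_le_measureReal_gsNormSq hn1 hp (hν.map_rotation n hn1) (hν.zero n hn1) hX
    (a := a n) hc hcρ hρ1 hA hA' h₁ h₂
  rw [(hasLaw_chiSqSeq_rev n p hp).measureReal_eq (p := (· ∈ A)) hA]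
  change (Measure.pi fun j : Fin p => chiSq (n - j)).real A ≤ _
  have hpn : (p : ℝ) ≤ n := by exact_mod_cast hp
  have e1 : (p : ℝ) * (ν n).real {x | ρ ≤ |‖x‖ ^ 2 / a n - 1|} ≤ n * (d₁ * r ^ n) := by
    have := hconc n hn1 ρ ⟨hρ0, hρρ₀⟩
    rw [hr, ← Real.exp_nat_mul]
    refine mul_le_mul hpn (this.trans (le_of_eq ?_)) measureReal_nonneg (by positivity)
    congr 2
    ring
  have e2 : (p : ℝ) * (chiSq n).real {x | ρ * n ≤ |x - n|} ≤ n * (2 * q ^ n) :=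
    mul_le_mul hpn (hq n) measureReal_nonneg (by positivity)
  linarith

lemma measure_eq_comp_of_indepFun {Ω β : Type*} [MeasurableSpace Ω] [MeasurableSpace β]
    {P : Measure Ω} [IsProbabilityMeasure P] {X : Ω → ℝ} {Y : Ω → β} (hX : Measurable X)
    (hY : Measurable Y) (h : IndepFun X Y P) (h0 : ∀ c, P.map X {c} = 0) {f : β → ℝ}
    (hf : Measurable f) : P {ω | X ω = f (Y ω)} = 0 := by
  have hm : MeasurableSet {q : ℝ × β | q.1 = f q.2} :=
    measurableSet_eq_fun measurable_fst (hf.comp measurable_snd)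
  have h1 : P {ω | X ω = f (Y ω)} = P.map (fun ω => (X ω, Y ω)) {q | q.1 = f q.2} := by
    rw [Measure.map_apply (hX.prodMk hY) hm]
    rfl
  have : IsProbabilityMeasure (P.map X) := Measure.isProbabilityMeasure_map hX.aemeasurable
  have : IsProbabilityMeasure (P.map Y) := Measure.isProbabilityMeasure_map hY.aemeasurable
  rw [h1, (indepFun_iff_map_prod_eq_prod_map_map hX.aemeasurable hY.aemeasurable).1 h,
    Measure.prod_apply_symm hm]
  refine lintegral_eq_zero_of_ae_eq_zero (ae_of_all _ fun y => ?_)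
  exact h0 (f y)

/-- An atomless variable almost surely avoids any measurable function of variables independent of
it. -/
lemma ae_chiSqSeq_ne {i : ℕ} (hi : 1 ≤ i) {T : Finset ℕ} (hT : i ∉ T) {f : (T → ℝ) → ℝ}
    (hf : Measurable f) : ∀ᵐ η ∂chiSqSeq, η i ≠ f fun k => η k := by
  have h1 := iIndepFun_chiSqSeq.indepFun_finset {i} T (by simpa using hT) fun k =>
    measurable_pi_apply k
  have hφ : Measurable fun x : ({i} : Finset ℕ) → ℝ => x ⟨i, by simp⟩ := measurable_pi_apply _
  have h2 := h1.comp hφ measurable_id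
  have h3 := measure_eq_comp_of_indepFun (hφ.comp (by fun_prop))
    (measurable_id.comp (by fun_prop)) h2 (fun c => by
    have : (fun x : ({i} : Finset ℕ) → ℝ => x ⟨i, by simp⟩) ∘ (fun (a : ℕ → ℝ)
        (k : ({i} : Finset ℕ)) => a k) = fun η : ℕ → ℝ => η i := rfl
    rw [this, (hasLaw_chiSqSeq i).map_eq]
    exact chiSq_singleton hi c) hf
  exact measure_eq_zero_iff_ae_notMem.1 h3

lemma ae_chiSqSeq_pos : ∀ᵐ η ∂chiSqSeq, ∀ k, 1 ≤ k → 0 < η k := by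
  rw [ae_all_iff]
  intro k
  by_cases hk : 1 ≤ k
  · have h := ae_chiSq_pos hk
    rw [← (hasLaw_chiSqSeq k).map_eq] at h
    filter_upwards [ae_of_ae_map (hasLaw_chiSqSeq k).aemeasurable h] with η hη _ using hη
  · exact ae_of_all _ fun _ h => absurd h hk

/-- Exponential concentration makes the deviation probabilities summable, so Borel–Cantelli applies
at each of countably many precisions. -/
lemma ae_chiSqSeq_tendsto :
    ∀ᵐ η ∂chiSqSeq, Tendsto (fun k : ℕ => η k / (k : ℝ)) atTop (𝓝 1) := by
  have h1 : ∀ m : ℕ, ∀ᵐ η ∂chiSqSeq, ∀ᶠ k : ℕ in atTop,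
      ¬ (1 / ((m : ℝ) + 2) * k ≤ |η k - (k : ℝ)|) := by
    intro m
    obtain ⟨q, hq0, hq1, hq⟩ := exists_chiSq_concentration (ρ := 1 / ((m : ℝ) + 2)) (by positivity)
      (by rw [div_lt_one (by positivity)]; linarith [(Nat.cast_nonneg m : (0 : ℝ) ≤ m)])
    refine ae_eventually_notMem
      (s := fun k : ℕ => {η : ℕ → ℝ | 1 / ((m : ℝ) + 2) * k ≤ |η k - (k : ℝ)|})
      (ne_top_of_le_ne_top (b := ∑' k : ℕ, ENNReal.ofReal (2 * q ^ k)) ?_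
        (ENNReal.tsum_le_tsum fun k => ?_))
    · exact ((summable_geometric_of_lt_one hq0 hq1).mul_left 2).tsum_ofReal_ne_top
    · rw [← ofReal_measureReal]
      refine ENNReal.ofReal_le_ofReal ?_
      have := (hasLaw_chiSqSeq k).measureReal_eq
        (p := fun x => 1 / ((m : ℝ) + 2) * k ≤ |x - k|)
        (measurableSet_le (by fun_prop) (by fun_prop))
      rw [this]
      exact hq k
  filter_upwards [ae_all_iff.2 h1] with η hη
  rw [Metric.tendsto_atTop']
  intro ε hε
  obtain ⟨m, hm⟩ := exists_nat_one_div_lt hε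
  obtain ⟨K, hK⟩ := eventually_atTop.1 (hη m)
  refine ⟨K, fun k hk => ?_⟩
  have hk0 : (0 : ℝ) < k := by exact_mod_cast (Nat.zero_le K).trans_lt hk
  have h2 := not_le.1 (hK k hk.le)
  have h3 : η k / (k : ℝ) - 1 = (η k - (k : ℝ)) / k := by field_simp
  rw [Real.dist_eq, h3, abs_div, abs_of_pos hk0, div_lt_iff₀ hk0]
  refine h2.trans ?_
  gcongr
  refine lt_of_le_of_lt ?_ hm
  gcongr
  norm_num

/-! ### Almost sure behaviour of the ratios -/

/-- The ratio of consecutive terms of a sequence, numbered as the limits of the local ratios. -/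
noncomputable def seqRatio (η : ℕ → ℝ) (i : ℕ) : ℝ := η (i + 1) / η (i + 2)

@[fun_prop]
lemma measurable_seqRatio (i : ℕ) : Measurable fun η => seqRatio η i := by
  unfold seqRatio; fun_prop

lemma ae_seqRatio_tendsto : ∀ᵐ η ∂chiSqSeq, Tendsto (seqRatio η) atTop (𝓝 1) := by
  filter_upwards [ae_chiSqSeq_tendsto, ae_chiSqSeq_pos] with η h hpos
  have h1 := (tendsto_add_atTop_iff_nat 1).2 h
  have h2 := (tendsto_add_atTop_iff_nat 2).2 h
  have h3 : Tendsto (fun i : ℕ => ((i + 1 : ℕ) : ℝ) / ((i + 2 : ℕ) : ℝ)) atTop (𝓝 1) := by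
    have := (tendsto_add_atTop_iff_nat 1).2 (tendsto_natCast_div_add_atTop (1 : ℝ))
    refine this.congr fun i => ?_
    push_cast
    ring_nf
  have h4 := (h1.div h2 one_ne_zero).mul h3
  simp only [div_one, mul_one] at h4
  refine h4.congr fun i => ?_
  have := hpos (i + 2) (by omega)
  simp only [seqRatio, Pi.div_apply]
  push_cast
  field_simp

lemma ae_seqRatio_ne_const (i : ℕ) (c : ℝ) : ∀ᵐ η ∂chiSqSeq, seqRatio η i ≠ c := by
  have h := ae_chiSqSeq_ne (i := i + 1) (by omega) (T := {i + 2}) (by simp)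
    (f := fun x => c * x ⟨i + 2, by simp⟩) (by fun_prop)
  filter_upwards [h, ae_chiSqSeq_pos] with η h hpos heq
  have := hpos (i + 2) (by omega)
  rw [seqRatio, div_eq_iff this.ne'] at heq
  exact h heq

lemma ae_seqRatio_injective : ∀ᵐ η ∂chiSqSeq, Function.Injective (seqRatio η) := by
  have h : ∀ᵐ η ∂chiSqSeq, ∀ i j, i < j → seqRatio η i ≠ seqRatio η j := by
    rw [ae_all_iff]; intro i
    rw [ae_all_iff]; intro j
    by_cases hij : i < j
    swap
    · exact ae_of_all _ fun _ h => absurd h hij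
    -- Equality of the two ratios would determine `η (i + 1)` from terms of larger index. This
    -- remains so when `j = i + 1`, where two of the three indices coincide.
    have h := ae_chiSqSeq_ne (i := i + 1) (by omega) (T := {i + 2, j + 1, j + 2})
      (by simp; omega)
      (f := fun x => x ⟨j + 1, by simp⟩ / x ⟨j + 2, by simp⟩ * x ⟨i + 2, by simp⟩) (by fun_prop)
    filter_upwards [h, ae_chiSqSeq_pos] with η h hpos _ heq
    have := hpos (i + 2) (by omega)
    rw [seqRatio, div_eq_iff this.ne'] at heq
    exact h heq
  filter_upwards [h] with η h i j hij
  by_contra hne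
  rcases lt_or_gt_of_ne hne with hl | hl
  · exact h i j hl hij
  · exact h j i hl hij.symm

/-- Almost surely there are arbitrarily late ratios below `1`. -/
lemma ae_exists_seqRatio_lt_one (g : ℕ) : ∀ᵐ η ∂chiSqSeq, ∃ i, g ≤ i ∧ seqRatio η i < 1 := by
  filter_upwards [ae_chiSqSeq_tendsto, ae_chiSqSeq_pos] with η h hpos
  by_contra! hcon
  -- If all late ratios were at least 1, the sequence would not increase from `g + 1` on,
  -- contradicting `η k / k → 1`.
  have hanti : ∀ i, η (g + 1 + i) ≤ η (g + 1) := by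
    intro i
    induction i with
    | zero => simp
    | succ i ih =>
      have h1 := hcon (g + i) (by omega)
      rw [seqRatio, one_le_div (hpos _ (by omega))] at h1
      have e1 : g + 1 + (i + 1) = g + i + 2 := by omega
      have e2 : g + 1 + i = g + i + 1 := by omega
      rw [e1]
      rw [e2] at ih
      exact h1.trans ih
  have h2 : Tendsto (fun k : ℕ => η (g + 1) / (k : ℝ)) atTop (𝓝 0) :=
    tendsto_const_div_atTop_nhds_zero_nat _
  refine absurd (le_of_tendsto_of_tendsto h h2 ?_) (by norm_num)
  filter_upwards [eventually_ge_atTop (g + 1)] with k hk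
  obtain ⟨i, rfl⟩ := Nat.exists_eq_add_of_le hk
  gcongr
  exact hanti i

lemma tendsto_measureReal_seqRatio_gt {t : ℝ} (ht : t < 1) :
    Tendsto (fun m => chiSqSeq.real {η | ∀ i, m ≤ i → t < seqRatio η i}) atTop (𝓝 1) := by
  have hmono : Monotone fun m : ℕ => {η : ℕ → ℝ | ∀ i, m ≤ i → t < seqRatio η i} :=
    fun m m' hm η hη i hi => hη i (hm.trans hi)
  have h := tendsto_measure_iUnion_atTop (μ := chiSqSeq) hmono
  have h1 : chiSqSeq (⋃ m : ℕ, {η | ∀ i, m ≤ i → t < seqRatio η i}) = 1 := by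
    rw [← mem_ae_iff_prob_eq_one₀]
    · filter_upwards [ae_seqRatio_tendsto] with η hη
      obtain ⟨K, hK⟩ := eventually_atTop.1 (hη.eventually (lt_mem_nhds ht))
      exact Set.mem_iUnion.2 ⟨K, hK⟩
    · refine (MeasurableSet.iUnion fun m => ?_).nullMeasurableSet
      measurability
  rw [h1] at h
  exact (ENNReal.tendsto_toReal ENNReal.one_ne_top).comp h

lemma measurableSet_seqRatio_gt (t : ℝ) (m : ℕ) :
    MeasurableSet {η | ∀ i, m ≤ i → t < seqRatio η i} := by
  measurability

lemma chiSqSeq_indep_tail (m : ℕ) {A B : Set (ℕ → ℝ)}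
    (hA : MeasurableSet[MeasurableSpace.comap (fun η : ℕ → ℝ => η m) inferInstance] A)
    (hB : MeasurableSet[⨆ k ∈ Set.Ioi m, MeasurableSpace.comap (fun η : ℕ → ℝ => η k)
      inferInstance] B) :
    chiSqSeq (A ∩ B) = chiSqSeq A * chiSqSeq B := by
  have h := indep_iSup_of_disjoint (fun k => (measurable_pi_apply k).comap_le)
    iIndepFun_chiSqSeq.iIndep (S := {m}) (T := Set.Ioi m) (by simp)
  rw [Indep_iff] at h
  exact h A B (le_biSup (fun k => MeasurableSpace.comap (fun η : ℕ → ℝ => η k) inferInstance)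
    (Set.mem_singleton m) A hA) hB

/-- Far tails have probability close to 1. One earlier ratio is added at a time: on a tail event
with `η (m + 2) < M`, it is enough that the independent variable `η (m + 1)` exceeds `t * M`, which
has positive probability. -/
lemma measureReal_seqRatio_gt_pos {t : ℝ} (ht0 : 0 < t) (ht : t < 1) (g : ℕ) :
    0 < chiSqSeq.real {η | ∀ i, g ≤ i → t < seqRatio η i} := by
  obtain ⟨K, hK⟩ := ((tendsto_measureReal_seqRatio_gt ht).eventually
    (lt_mem_nhds one_pos)).exists_forall_of_atTop
  have hstep : ∀ m, 0 < chiSqSeq {η | ∀ i, m + 1 ≤ i → t < seqRatio η i} →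
      0 < chiSqSeq {η | ∀ i, m ≤ i → t < seqRatio η i} := by
    intro m hm
    set B : ℕ → Set (ℕ → ℝ) := fun M =>
      {η | (∀ i, m + 1 ≤ i → t < seqRatio η i) ∧ η (m + 2) < M} with hB
    have hU : {η | ∀ i, m + 1 ≤ i → t < seqRatio η i} = ⋃ M, B M := by
      ext η
      simp only [hB, Set.mem_iUnion, Set.mem_ofPred_eq]
      constructor
      · intro h
        obtain ⟨M, hM⟩ := exists_nat_gt (η (m + 2))
        exact ⟨M, h, hM⟩
      · rintro ⟨M, h, -⟩
        exact h
    obtain ⟨M, hM⟩ : ∃ M, 0 < chiSqSeq (B M) := by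
      by_contra! hcon
      rw [hU, measure_iUnion_null fun M => le_antisymm (hcon M) (zero_le)] at hm
      exact lt_irrefl _ hm
    have hApos : 0 < chiSqSeq {η | t * M < η (m + 1)} := by
      rw [(hasLaw_chiSqSeq (m + 1)).measure_eq (p := fun x => t * M < x) measurableSet_Ioi]
      exact chiSq_pos_of_isOpen (by omega) isOpen_Ioi (x := t * M + 1) (by positivity)
        (by simp)
    have hind := chiSqSeq_indep_tail (m + 1) (A := {η | t * M < η (m + 1)}) (B := B M)
      ⟨Set.Ioi (t * M), measurableSet_Ioi, rfl⟩ (by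
        have hk : ∀ k ∈ Set.Ioi (m + 1), Measurable[⨆ k ∈ Set.Ioi (m + 1),
            MeasurableSpace.comap (fun η : ℕ → ℝ => η k) inferInstance]
            fun η : ℕ → ℝ => η k := fun k hk =>
          (comap_measurable _).mono (le_biSup (fun k => MeasurableSpace.comap
            (fun η : ℕ → ℝ => η k) inferInstance) hk) le_rfl
        have h1 : B M = (⋂ i ∈ Set.Ici (m + 1), {η | t < η (i + 1) / η (i + 2)})
            ∩ {η | η (m + 2) < (M : ℝ)} := by
          ext η
          simp [hB, seqRatio]
        rw [h1]
        refine MeasurableSet.inter (MeasurableSet.biInter (Set.to_countable _) fun i hi => ?_) ?_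
        · exact measurableSet_lt measurable_const ((hk (i + 1) (Nat.lt_succ_of_le hi)).div
            (hk (i + 2) (Nat.lt_succ_of_le (Nat.le_succ_of_le hi))))
        · exact measurableSet_lt (hk (m + 2) (Nat.lt_succ_self _)) measurable_const)
    have hpos : 0 < chiSqSeq ({η | t * M < η (m + 1)} ∩ B M) := by
      rw [hind]; exact ENNReal.mul_pos hApos.ne' hM.ne'
    refine hpos.trans_le (measure_mono_ae ?_)
    filter_upwards [ae_chiSqSeq_pos] with η hη h i hi
    obtain ⟨h1, h2, h3⟩ := h
    rcases hi.eq_or_lt with rfl | hi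
    · rw [seqRatio, lt_div_iff₀ (hη _ (by omega))]
      refine lt_trans ?_ h1
      gcongr
    · exact h2 i hi
  have hall : ∀ d m, m + d = K + g → 0 < chiSqSeq {η | ∀ i, m ≤ i → t < seqRatio η i} := by
    intro d
    induction d with
    | zero =>
      intro m hm
      have := hK m (by omega)
      exact (ENNReal.toReal_pos_iff.1 this).1
    | succ d ih => exact fun m hm => hstep m (ih (m + 1) (by omega))
  exact ENNReal.toReal_pos (hall K g (by omega)).ne' (measure_ne_top _ _)

/-- With positive probability `η (g + 1) < t` and `η (g + 2) > 1`, and then the first ratio is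
already too small. -/
lemma measureReal_seqRatio_gt_lt_one {t : ℝ} (ht0 : 0 < t) (g : ℕ) :
    chiSqSeq.real {η | ∀ i, g ≤ i → t < seqRatio η i} < 1 := by
  have hind := (iIndepFun_chiSqSeq.indepFun (i := g + 1) (j := g + 2)
    (by omega)).measure_inter_preimage_eq_mul (Set.Iio t) (Set.Ioi 1) measurableSet_Iio measurableSet_Ioi
  have hpos : 0 < chiSqSeq ((fun η : ℕ → ℝ => η (g + 1)) ⁻¹' Set.Iio t ∩
      (fun η : ℕ → ℝ => η (g + 2)) ⁻¹' Set.Ioi 1) := by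
    rw [hind]
    refine ENNReal.mul_pos (ne_of_gt ?_) (ne_of_gt ?_)
    · rw [show (fun η : ℕ → ℝ => η (g + 1)) ⁻¹' Set.Iio t = {η | η (g + 1) ∈ Set.Iio t} from rfl,
        (hasLaw_chiSqSeq (g + 1)).measure_eq (p := (· ∈ Set.Iio t)) measurableSet_Iio]
      exact chiSq_pos_of_isOpen (by omega) isOpen_Iio le_rfl ht0
    · rw [show (fun η : ℕ → ℝ => η (g + 2)) ⁻¹' Set.Ioi 1 = {η | η (g + 2) ∈ Set.Ioi 1} from rfl,
        (hasLaw_chiSqSeq (g + 2)).measure_eq (p := (· ∈ Set.Ioi 1)) measurableSet_Ioi]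
      exact chiSq_pos_of_isOpen (by omega) isOpen_Ioi (x := 2) (by norm_num) (by simp)
  have hpos' : 0 < chiSqSeq.real {η | ∀ i, g ≤ i → t < seqRatio η i}ᶜ := by
    refine ENNReal.toReal_pos (ne_of_gt (hpos.trans_le (measure_mono ?_))) (measure_ne_top _ _)
    rintro η ⟨h1, h2⟩ h
    have h3 := h g le_rfl
    simp only [Set.mem_preimage, Set.mem_Iio, Set.mem_Ioi] at h1 h2
    rw [seqRatio, lt_div_iff₀ (by linarith)] at h3
    nlinarith
  rw [probReal_compl_eq_one_sub (measurableSet_seqRatio_gt t g)] at hpos'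
  linarith

/-! ### Transfer of the events on local ratios -/

/-- The ratio of consecutive entries of a vector. -/
noncomputable def vecRatio {p : ℕ} (x : Fin p → ℝ) (j : Fin (p - 1)) : ℝ :=
  x ⟨j + 1, by omega⟩ / x ⟨j, by omega⟩

@[fun_prop]
lemma measurable_vecRatio {p : ℕ} (j : Fin (p - 1)) :
    Measurable fun x : Fin p → ℝ => vecRatio x j := by
  unfold vecRatio
  exact (measurable_pi_apply _).div (measurable_pi_apply _)

lemma vecRatio_pos {p : ℕ} {x : Fin p → ℝ} (hx : ∀ j, 0 < x j) (j : Fin (p - 1)) :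
    0 < vecRatio x j := div_pos (hx _) (hx _)

lemma localRatio_eq_vecRatio {n p : ℕ} (b : Fin p → EuclideanSpace ℝ (Fin n)) (j : Fin (p - 1)) :
    localRatio b j = vecRatio (gsNormSq b) j := rfl

/-- The ratio number `j` compares `n - j - 1` with `n - j` degrees of freedom, and `n - j - 2` is
the index counted from the end that `worstIndex` uses. -/
lemma vecRatio_rev {n p : ℕ} (hp : p ≤ n) (η : ℕ → ℝ) (j : Fin (p - 1)) :
    vecRatio (fun j : Fin p => η (n - j)) j = seqRatio η (n - j - 2) := by
  have := j.2
  simp only [vecRatio, seqRatio]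
  congr 2 <;> omega

lemma NearlyProportional.pos {ι : Type*} {c : ℝ} {x y : ι → ℝ} (h : NearlyProportional c x y)
    (hx : ∀ j, 0 < x j) (j : ι) : 0 < y j := by
  obtain ⟨l, h0, -, h2⟩ := h
  rw [h2]
  exact mul_pos (h0 j) (hx j)

lemma NearlyProportional.mul_vecRatio_le {p : ℕ} {c : ℝ} {x y : Fin p → ℝ}
    (h : NearlyProportional c x y) (hx : ∀ j, 0 < x j) (j : Fin (p - 1)) :
    c * vecRatio x j ≤ vecRatio y j := by
  obtain ⟨l, h0, h1, h2⟩ := h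
  simp only [vecRatio, h2]
  rw [mul_div_mul_comm]
  have := vecRatio_pos hx j
  refine mul_le_mul_of_nonneg_right ?_ this.le
  rw [le_div_iff₀ (h0 _)]
  exact h1 _ _

lemma linearIndependent_iff_gsNormSq_pos {n p : ℕ} (b : Fin p → EuclideanSpace ℝ (Fin n)) :
    LinearIndependent ℝ b ↔ ∀ j, 0 < gsNormSq b j := by
  constructor
  · intro h j
    have := InnerProductSpace.gramSchmidt_ne_zero (𝕜 := ℝ) j h
    rw [gsNormSq]
    positivity
  · intro h
    refine linearIndependent_of_gramSchmidt_ne_zero b fun j h0 => ?_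
    have := h j
    rw [gsNormSq, h0] at this
    simp at this

/-- The square is there because the transfer principle makes two comparisons, each costing a factor
`c`. -/
lemma exists_sq_gt {v : ℝ} (hv : v < 1) : ∃ c : ℝ, 0 < c ∧ c < 1 ∧ v ≤ c ^ 2 := by
  refine ⟨(1 + max v 0) / 2, by positivity, ?_, ?_⟩
  · have : max v 0 < 1 := max_lt hv one_pos
    linarith
  · nlinarith [le_max_left v 0, sq_nonneg (1 - max v 0)]

section

variable {ν : (n : ℕ) → Measure (EuclideanSpace ℝ (Fin n))}

lemma eventually_le_measureReal_isSiegelReduced (hν : IsSphericalModel ν)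
    (hconc : RadialConcentration ν) {s t δ : ℝ} (ht0 : 0 < t) (hst : s ^ 2 < t) (hδ : 0 < δ) :
    ∀ᶠ n : ℕ in atTop, ∀ p ≤ n, ∀ (Ω : Type u) [MeasurableSpace Ω] (P : Measure Ω)
      [IsProbabilityMeasure P] (b : Fin p → Ω → EuclideanSpace ℝ (Fin n)),
      IsRandomBasis P (ν n) b →
      chiSqSeq.real {η | ∀ i, n - p ≤ i → t < seqRatio η i}
        ≤ P.real {ω | IsSiegelReduced s fun i => b i ω} + δ := by
  obtain ⟨c, hc0, hc1, hc⟩ := exists_sq_gt (v := s ^ 2 / t) ((div_lt_one ht0).2 hst)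
  rw [div_le_iff₀ ht0] at hc
  filter_upwards [eventually_chiSqSeq_le hν hconc hc0 hc1 hδ] with n hn p hp Ω _ P _ b hb
  have hmeas : ∀ r : ℝ, MeasurableSet
      {x : Fin p → ℝ | (∀ j, 0 < x j) ∧ ∀ j, r < vecRatio x j} := by
    intro r
    measurability
  have step : ∀ r r' : ℝ, r' ≤ c * r → ∀ x y : Fin p → ℝ, NearlyProportional c x y →
      x ∈ {x : Fin p → ℝ | (∀ j, 0 < x j) ∧ ∀ j, r < vecRatio x j} →
      y ∈ {x : Fin p → ℝ | (∀ j, 0 < x j) ∧ ∀ j, r' < vecRatio x j} := by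
    rintro r r' hr x y hxy ⟨h1, h2⟩
    refine ⟨hxy.pos h1, fun j => ?_⟩
    calc r' ≤ c * r := hr
      _ < c * vecRatio x j := mul_lt_mul_of_pos_left (h2 j) hc0
      _ ≤ _ := hxy.mul_vecRatio_le h1 j
  have key := hn p hp Ω P b hb _ _ _ (hmeas t) (hmeas (c * t)) (step t (c * t) le_rfl)
    (step (c * t) (s ^ 2) (by linarith))
  refine le_trans (ENNReal.toReal_mono (measure_ne_top _ _) (measure_mono_ae ?_)) (key.trans ?_)
  · filter_upwards [ae_chiSqSeq_pos] with η hη h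
    refine ⟨fun j => hη _ (by omega), fun j => ?_⟩
    rw [vecRatio_rev hp]
    exact h _ (by omega)
  · refine add_le_add_left (measureReal_mono ?_) _
    rintro ω ⟨h1, h2⟩
    exact ⟨(linearIndependent_iff_gsNormSq_pos _).2 h1, h2⟩

lemma eventually_le_measureReal_not_isSiegelReduced (hν : IsSphericalModel ν)
    (hconc : RadialConcentration ν) {s t δ : ℝ} (hs : 0 < s) (hst : t < s ^ 2) (hδ : 0 < δ) :
    ∀ᶠ n : ℕ in atTop, ∀ p ≤ n, ∀ (Ω : Type u) [MeasurableSpace Ω] (P : Measure Ω)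
      [IsProbabilityMeasure P] (b : Fin p → Ω → EuclideanSpace ℝ (Fin n)),
      IsRandomBasis P (ν n) b →
      chiSqSeq.real {η | ∃ i, n - p ≤ i ∧ i + 2 ≤ n ∧ seqRatio η i < t}
        ≤ P.real {ω | ¬ IsSiegelReduced s fun i => b i ω} + δ := by
  have hs2 : 0 < s ^ 2 := by positivity
  obtain ⟨c, hc0, hc1, hc⟩ := exists_sq_gt (v := t / s ^ 2) ((div_lt_one hs2).2 hst)
  rw [div_le_iff₀ hs2] at hc
  filter_upwards [eventually_chiSqSeq_le hν hconc hc0 hc1 hδ] with n hn p hp Ω _ P _ b hb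
  have hmeas : ∀ r : ℝ, MeasurableSet
      {x : Fin p → ℝ | (∀ j, 0 < x j) ∧ ∃ j, vecRatio x j < r} := by
    intro r
    measurability
  have step : ∀ r r' : ℝ, r ≤ c * r' → ∀ x y : Fin p → ℝ, NearlyProportional c x y →
      x ∈ {x : Fin p → ℝ | (∀ j, 0 < x j) ∧ ∃ j, vecRatio x j < r} →
      y ∈ {x : Fin p → ℝ | (∀ j, 0 < x j) ∧ ∃ j, vecRatio x j < r'} := by
    rintro r r' hr x y hxy ⟨h1, j, h2⟩
    refine ⟨hxy.pos h1, j, lt_of_mul_lt_mul_left ?_ hc0.le⟩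
    calc c * vecRatio y j ≤ vecRatio x j := hxy.symm.mul_vecRatio_le (hxy.pos h1) j
      _ < r := h2
      _ ≤ _ := hr
  have key := hn p hp Ω P b hb _ _ _ (hmeas t) (hmeas (c * s ^ 2))
    (step t (c * s ^ 2) (by linarith)) (step (c * s ^ 2) (s ^ 2) le_rfl)
  refine le_trans (ENNReal.toReal_mono (measure_ne_top _ _) (measure_mono_ae ?_)) (key.trans ?_)
  · filter_upwards [ae_chiSqSeq_pos] with η hη h
    obtain ⟨i, h1, h2, h3⟩ := h
    refine ⟨fun j => hη _ (by omega), ⟨n - i - 2, by omega⟩, ?_⟩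
    rw [vecRatio_rev hp]
    convert h3 using 2
    simp only
    omega
  · refine add_le_add_left (measureReal_mono ?_) _
    rintro ω ⟨-, j, h2⟩ h
    exact lt_asymm h2 (h.2 j)

lemma worstIndex_eq {n p : ℕ} {b : Fin p → EuclideanSpace ℝ (Fin n)} {k : ℕ} {j₀ : Fin (p - 1)}
    (hk : (j₀ : ℕ) + k + 2 = n) (h : ∀ j, j ≠ j₀ → localRatio b j₀ < localRatio b j) :
    worstIndex b = k := by
  have hlevel : reductionLevel b = localRatio b j₀ := by
    have : Nonempty (Fin (p - 1)) := ⟨j₀⟩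
    refine le_antisymm (ciInf_le (Set.finite_range _).bddBelow j₀) (le_ciInf fun j => ?_)
    by_cases hj : j = j₀
    · rw [hj]
    · exact (h j hj).le
  have hset : {i : ℕ | ∃ j : Fin (p - 1), (j : ℕ) + i + 2 = n ∧
      localRatio b j = reductionLevel b} = {k} := by
    ext i
    simp only [Set.mem_ofPred_eq, Set.mem_singleton_iff, hlevel]
    constructor
    · rintro ⟨j, h1, h2⟩
      have : j = j₀ := by
        by_contra hj
        exact (h j hj).ne' h2
      subst this
      omega
    · rintro rfl
      exact ⟨j₀, hk, rfl⟩
  rw [worstIndex, hset, csInf_singleton]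

/-- A minimum that beats all other ratios by a factor `t < 1` stays the strict minimum under small
perturbations of the lengths. -/
lemma eventually_le_measureReal_worstIndex (hν : IsSphericalModel ν)
    (hconc : RadialConcentration ν) {t δ : ℝ} (ht : t < 1) (hδ : 0 < δ) (K : Set ℕ) :
    ∀ᶠ n : ℕ in atTop, ∀ p ≤ n, ∀ (Ω : Type u) [MeasurableSpace Ω] (P : Measure Ω)
      [IsProbabilityMeasure P] (b : Fin p → Ω → EuclideanSpace ℝ (Fin n)),
      IsRandomBasis P (ν n) b →
      chiSqSeq.real {η | ∃ k ∈ K, n - p ≤ k ∧ k + 2 ≤ n ∧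
          ∀ i, n - p ≤ i → i ≠ k → seqRatio η k < t * seqRatio η i}
        ≤ P.real {ω | worstIndex (fun i => b i ω) ∈ K} + δ := by
  -- Each comparison may raise the least ratio and lower another, so it costs `c ^ 2`. The margin
  -- passes from `t` to `d` to 1, which is allowed since `t ≤ d ^ 2 ≤ c ^ 2 * d` and `d ≤ c ^ 2`.
  obtain ⟨d, hd0, hd1, hd⟩ := exists_sq_gt ht
  obtain ⟨c, hc0, hc1, hc⟩ := exists_sq_gt hd1
  filter_upwards [eventually_chiSqSeq_le hν hconc hc0 hc1 hδ] with n hn p hp Ω _ P _ b hb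
  set W : ℝ → Set (Fin p → ℝ) := fun r => {x | (∀ j, 0 < x j) ∧ ∃ j₀ : Fin (p - 1),
    (∃ k ∈ K, (j₀ : ℕ) + k + 2 = n) ∧ ∀ j, j ≠ j₀ → vecRatio x j₀ < r * vecRatio x j} with hW
  have hmeas : ∀ r : ℝ, MeasurableSet (W r) := by
    intro r
    have h : W r = (⋂ j, {x | 0 < x j}) ∩ ⋃ j₀ : Fin (p - 1), {_x | ∃ k ∈ K, (j₀ : ℕ) + k + 2 = n} ∩
        ⋂ j, ⋂ (_ : j ≠ j₀), {x | vecRatio x j₀ < r * vecRatio x j} := by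
      ext x
      simp [hW]
    rw [h]
    refine (MeasurableSet.iInter fun j => ?_).inter (MeasurableSet.iUnion fun j₀ =>
      (MeasurableSet.const _).inter (MeasurableSet.iInter fun j => MeasurableSet.iInter fun _ => ?_))
    · exact measurableSet_lt (by fun_prop) (by fun_prop)
    · exact measurableSet_lt (by fun_prop) (by fun_prop)
  have step : ∀ r r' : ℝ, 0 < r' → r ≤ c ^ 2 * r' → ∀ x y : Fin p → ℝ, NearlyProportional c x y →
      x ∈ W r → y ∈ W r' := by
    rintro r r' hr' hr x y hxy ⟨h1, j₀, h2, h3⟩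
    refine ⟨hxy.pos h1, j₀, h2, fun j hj => lt_of_mul_lt_mul_left ?_ hc0.le⟩
    calc c * vecRatio y j₀ ≤ vecRatio x j₀ := hxy.symm.mul_vecRatio_le (hxy.pos h1) j₀
      _ < r * vecRatio x j := h3 j hj
      _ ≤ c ^ 2 * r' * vecRatio x j := mul_le_mul_of_nonneg_right hr (vecRatio_pos h1 j).le
      _ = c * r' * (c * vecRatio x j) := by ring
      _ ≤ c * r' * vecRatio y j :=
        mul_le_mul_of_nonneg_left (hxy.mul_vecRatio_le h1 j) (by positivity)
      _ = _ := by ring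
  have key := hn p hp Ω P b hb _ _ _ (hmeas t) (hmeas d)
    (step t d hd0 (by nlinarith)) (step d 1 one_pos (by linarith))
  refine le_trans (ENNReal.toReal_mono (measure_ne_top _ _) (measure_mono_ae ?_)) (key.trans ?_)
  · filter_upwards [ae_chiSqSeq_pos] with η hη h
    obtain ⟨k, hkK, h1, h2, h3⟩ := h
    refine ⟨fun j => hη _ (by omega), ⟨n - k - 2, by omega⟩, ⟨k, hkK, by simp only; omega⟩,
      fun j hj => ?_⟩
    rw [vecRatio_rev hp, vecRatio_rev hp]
    have e : n - (n - k - 2) - 2 = k := by omega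
    simp only [e]
    refine h3 _ (by omega) fun h => hj ?_
    ext
    simp only
    omega
  · refine add_le_add_left (measureReal_mono ?_) _
    rintro ω ⟨-, j₀, ⟨k, hkK, hk⟩, h⟩
    have : worstIndex (fun i => b i ω) = k := worstIndex_eq hk fun j hj => by
      rw [localRatio_eq_vecRatio, localRatio_eq_vecRatio]
      simpa using h j hj
    change worstIndex (fun i => b i ω) ∈ K
    rwa [this]

end

/-! ### Measurability and the limit index -/

lemma measurable_sInf_nat {α : Type*} [MeasurableSpace α] {S : α → ℕ → Prop}
    (hS : ∀ k, MeasurableSet {a | S a k}) : Measurable fun a => sInf {k | S a k} := by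
  -- The second alternative holds for every `k` when no `S a k` does, so that `Nat.find` returns 0,
  -- the value of `sInf ∅`.
  classical
  have h : (fun a => sInf {k | S a k})
      = fun a => Nat.find (p := fun k => S a k ∨ ∀ j, ¬ S a j)
          (by by_cases h : ∃ k, S a k
              · exact ⟨h.choose, Or.inl h.choose_spec⟩
              · exact ⟨0, Or.inr (not_exists.1 h)⟩) := by
    ext a
    symm
    rw [Nat.find_eq_iff]
    by_cases h : ∃ k, S a k
    · refine ⟨Or.inl (Nat.sInf_mem (s := {k | S a k}) h), fun m hm => ?_⟩
      rintro (h' | h')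
      · exact Nat.notMem_of_lt_sInf hm h'
      · exact h' _ h.choose_spec
    · have h0 : {k | S a k} = ∅ := by
        ext k
        simpa using not_exists.1 h k
      rw [h0, Nat.sInf_empty]
      exact ⟨Or.inr (not_exists.1 h), fun m hm => absurd hm (Nat.not_lt_zero m)⟩
  rw [h]
  refine measurable_find _ fun k => ?_
  have h1 : {a | S a k ∨ ∀ j, ¬ S a j} = {a | S a k} ∪ ⋂ j, {a | S a j}ᶜ := by
    ext a
    simp
  rw [h1]
  exact (hS k).union (MeasurableSet.iInter fun j => (hS j).compl)

lemma measurable_worstIndex {n p : ℕ} :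
    Measurable (worstIndex : (Fin p → EuclideanSpace ℝ (Fin n)) → ℕ) := by
  have hr : ∀ j : Fin (p - 1),
      Measurable fun b : Fin p → EuclideanSpace ℝ (Fin n) => localRatio b j := fun j =>
    (measurable_vecRatio j).comp measurable_gsNormSq
  have hl : Measurable fun b : Fin p → EuclideanSpace ℝ (Fin n) => reductionLevel b :=
    Measurable.iInf hr
  refine measurable_sInf_nat fun i => ?_
  simp only [Set.ofPred_exists, Set.ofPred_and]
  exact MeasurableSet.iUnion fun j => (MeasurableSet.const _).inter (measurableSet_eq_fun (hr j) hl)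

lemma measurableSet_isSiegelReduced {n p : ℕ} (s : ℝ) :
    MeasurableSet {b : Fin p → EuclideanSpace ℝ (Fin n) | IsSiegelReduced s b} := by
  have h : {b : Fin p → EuclideanSpace ℝ (Fin n) | IsSiegelReduced s b}
      = gsNormSq ⁻¹' {x : Fin p → ℝ | (∀ j, 0 < x j) ∧ ∀ j, s ^ 2 < vecRatio x j} := by
    ext b
    simp [IsSiegelReduced, linearIndependent_iff_gsNormSq_pos, localRatio_eq_vecRatio]
  rw [h]
  exact measurable_gsNormSq (by measurability)

/-- By continuity from below, the safety margin in the transferred events can be removed after the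
limit in `n` has been taken. -/
lemma eventually_measureReal_iUnion_le {Ω : Type*} [MeasurableSpace Ω] {Q : Measure Ω}
    [IsProbabilityMeasure Q] {B : ℕ → Set Ω} (hB : Monotone B) {x : ℕ → ℝ}
    (h : ∀ m, ∀ δ > 0, ∀ᶠ n in atTop, Q.real (B m) ≤ x n + δ) {δ : ℝ} (hδ : 0 < δ) :
    ∀ᶠ n in atTop, Q.real (⋃ m, B m) ≤ x n + δ := by
  have h1 : Tendsto (fun m => Q.real (B m)) atTop (𝓝 (Q.real (⋃ m, B m))) :=
    (ENNReal.tendsto_toReal (measure_ne_top _ _)).comp (tendsto_measure_iUnion_atTop hB)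
  obtain ⟨m, hm⟩ := (h1.eventually (lt_mem_nhds (sub_lt_self _ (half_pos hδ)))).exists
  filter_upwards [h m (δ / 2) (half_pos hδ)] with n hn
  linarith

/-- The position of the least ratio `seqRatio η i` with `g ≤ i`. -/
noncomputable def seqWorstIndex (g : ℕ) (η : ℕ → ℝ) : ℕ :=
  sInf {k | g ≤ k ∧ ∀ i, g ≤ i → seqRatio η k ≤ seqRatio η i}

lemma measurable_seqWorstIndex (g : ℕ) : Measurable (seqWorstIndex g) := by
  refine measurable_sInf_nat fun k => ?_
  have h : {η | g ≤ k ∧ ∀ i, g ≤ i → seqRatio η k ≤ seqRatio η i}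
      = {_η | g ≤ k} ∩ ⋂ i, ⋂ (_ : g ≤ i), {η | seqRatio η k ≤ seqRatio η i} := by
    ext η
    simp
  rw [h]
  exact (MeasurableSet.const _).inter (MeasurableSet.iInter fun i => MeasurableSet.iInter fun _ =>
    measurableSet_le (by fun_prop) (by fun_prop))

/-- Almost surely the least ratio is attained exactly once, and the other ones stay away from it. -/
lemma ae_seqWorstIndex_gap (g : ℕ) : ∀ᵐ η ∂chiSqSeq, g ≤ seqWorstIndex g η ∧ ∃ t < 1, ∀ i, g ≤ i →
    i ≠ seqWorstIndex g η → seqRatio η (seqWorstIndex g η) < t * seqRatio η i := by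
  filter_upwards [ae_exists_seqRatio_lt_one g, ae_seqRatio_tendsto, ae_seqRatio_injective,
    ae_chiSqSeq_pos] with η ⟨i₀, hi₀, hlt⟩ hlim hinj hpos
  -- This level separates some ratio from the limit 1: all but finitely many ratios lie above `v`,
  -- so the minimum is attained in a finite range.
  set v := (seqRatio η i₀ + 1) / 2 with hv
  have hv0 : seqRatio η i₀ < v := by linarith
  have hv1 : v < 1 := by linarith
  obtain ⟨K, hK⟩ := eventually_atTop.1 (hlim.eventually (lt_mem_nhds hv1))
  obtain ⟨k, hk, hmin⟩ := (Finset.Icc g (max K i₀)).exists_min_image (seqRatio η)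
    ⟨i₀, Finset.mem_Icc.2 ⟨hi₀, le_max_right _ _⟩⟩
  have hkv : seqRatio η k < v :=
    (hmin i₀ (Finset.mem_Icc.2 ⟨hi₀, le_max_right _ _⟩)).trans_lt hv0
  have hk1 := (Finset.mem_Icc.1 hk).1
  have hall : ∀ i, g ≤ i → seqRatio η k ≤ seqRatio η i := by
    intro i hi
    by_cases h : i ≤ max K i₀
    · exact hmin i (Finset.mem_Icc.2 ⟨hi, h⟩)
    · exact hkv.le.trans (hK i ((le_max_left _ _).trans (not_le.1 h).le)).le
  have hset : {k | g ≤ k ∧ ∀ i, g ≤ i → seqRatio η k ≤ seqRatio η i} = {k} := by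
    ext j
    simp only [Set.mem_ofPred_eq, Set.mem_singleton_iff]
    constructor
    · rintro ⟨h1, h2⟩
      exact hinj (le_antisymm (h2 k hk1) (hall j h1))
    · rintro rfl
      exact ⟨hk1, hall⟩
  have hI : seqWorstIndex g η = k := by rw [seqWorstIndex, hset, csInf_singleton]
  rw [hI]
  refine ⟨hk1, ?_⟩
  -- A single `t` near 1 must serve for the finitely many competitors in the range and for `v`,
  -- which bounds all the others from below.
  have hcont : ∀ r : ℝ, seqRatio η k < r → ∀ᶠ t in 𝓝[<] (1 : ℝ), seqRatio η k < t * r := by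
    intro r hr
    have h1 : Tendsto (fun t : ℝ => t * r) (𝓝[<] 1) (𝓝 (1 * r)) :=
      (tendsto_id.mul_const r).mono_left nhdsWithin_le_nhds
    rw [one_mul] at h1
    exact h1.eventually (lt_mem_nhds hr)
  have hfin : ∀ᶠ t in 𝓝[<] (1 : ℝ), ∀ i ∈ Finset.Icc g (max K i₀), i ≠ k →
      seqRatio η k < t * seqRatio η i := by
    rw [Filter.eventually_all_finset]
    intro i hi
    by_cases hik : i = k
    · exact Eventually.of_forall fun _ h => absurd hik h
    · filter_upwards [hcont _ (lt_of_le_of_ne (hmin i hi) fun h => hik (hinj h.symm))] with t ht _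
      exact ht
  obtain ⟨t, h1, h2, h3, h4⟩ := (hfin.and ((hcont v hkv).and ((eventually_mem_nhdsWithin).and
    (nhdsWithin_le_nhds (lt_mem_nhds (zero_lt_one (α := ℝ))))))).exists
  refine ⟨t, h3, fun i hi hik => ?_⟩
  by_cases h : i ≤ max K i₀
  · exact h1 i (Finset.mem_Icc.2 ⟨hi, h⟩) hik
  · refine h2.trans_le (mul_le_mul_of_nonneg_left ?_ h4.le)
    exact (hK i ((le_max_left _ _).trans (not_le.1 h).le)).le

/-! ### Passage to the limit -/

section

variable {ν : (n : ℕ) → Measure (EuclideanSpace ℝ (Fin n))}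
  {Ω : ℕ → Type u} [∀ n, MeasurableSpace (Ω n)] {P : (n : ℕ) → Measure (Ω n)}
  [∀ n, IsProbabilityMeasure (P n)]

lemma IsRandomBasis.aemeasurable {n p : ℕ} {Ω : Type*} [MeasurableSpace Ω] {P : Measure Ω}
    {ν : Measure (EuclideanSpace ℝ (Fin n))} {b : Fin p → Ω → EuclideanSpace ℝ (Fin n)}
    (hb : IsRandomBasis P ν b) : AEMeasurable (fun ω i => b i ω) P :=
  aemeasurable_pi_lambda _ fun i => (hb.hasLaw i).aemeasurable

lemma tendsto_measureReal_isSiegelReduced_one (hν : IsSphericalModel ν)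
    (hconc : RadialConcentration ν) {s : ℝ} (hs : s ∈ Set.Ioo (0 : ℝ) 1) {g : ℕ → ℕ}
    (hgn : ∀ n, g n ≤ n) (hg : Tendsto g atTop atTop)
    {b : (n : ℕ) → Fin (n - g n) → Ω n → EuclideanSpace ℝ (Fin n)}
    (hb : ∀ n, IsRandomBasis (P n) (ν n) (b n)) :
    Tendsto (fun n => (P n).real {ω | IsSiegelReduced s (fun i => b n i ω)}) atTop (𝓝 1) := by
  have hs2 : s ^ 2 < 1 := by nlinarith [hs.1, hs.2]
  obtain ⟨t, hst, ht⟩ := exists_between hs2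
  have ht0 : 0 < t := (sq_nonneg s).trans_lt hst
  refine tendsto_order.2 ⟨fun x hx => ?_, fun x hx =>
    Eventually.of_forall fun n => measureReal_le_one.trans_lt hx⟩
  have hδ : 0 < (1 - x) / 2 := by linarith
  obtain ⟨m, hm⟩ := ((tendsto_measureReal_seqRatio_gt ht).eventually
    (lt_mem_nhds (sub_lt_self 1 hδ))).exists
  filter_upwards [eventually_le_measureReal_isSiegelReduced hν hconc ht0 hst hδ,
    hg.eventually_ge_atTop m] with n hn hgm
  have h1 := hn (n - g n) (Nat.sub_le _ _) (Ω n) (P n) (b n) (hb n)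
  have h2 : chiSqSeq.real {η | ∀ i, m ≤ i → t < seqRatio η i}
      ≤ chiSqSeq.real {η | ∀ i, n - (n - g n) ≤ i → t < seqRatio η i} :=
    measureReal_mono fun η hη i hi => hη i (by have := hgn n; omega)
  linarith

lemma tendsto_measureReal_isSiegelReduced (hν : IsSphericalModel ν)
    (hconc : RadialConcentration ν) {s : ℝ} (hs : 0 < s) {g : ℕ} (hs1 : s < 1)
    {b : (n : ℕ) → Fin (n - g) → Ω n → EuclideanSpace ℝ (Fin n)}
    (hb : ∀ n, IsRandomBasis (P n) (ν n) (b n)) :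
    Tendsto (fun n => (P n).real {ω | IsSiegelReduced s (fun i => b n i ω)}) atTop
      (𝓝 (chiSqSeq.real {η | ∀ i, g ≤ i → s ^ 2 < seqRatio η i})) := by
  set c := chiSqSeq.real {η | ∀ i, g ≤ i → s ^ 2 < seqRatio η i} with hc
  have hs2 : s ^ 2 < 1 := by nlinarith
  -- If all ratios exceed `s ^ 2`, they do so by a uniform margin: finitely many have their own
  -- margin, and the others are near 1. So the events with margin `1 / (m + 1)` exhaust the limit
  -- event.
  have hlow : ∀ δ > 0, ∀ᶠ n in atTop,
      c ≤ (P n).real {ω | IsSiegelReduced s (fun i => b n i ω)} + δ := by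
    intro δ hδ
    set B : ℕ → Set (ℕ → ℝ) := fun m =>
      {η | ∀ i, g ≤ i → s ^ 2 + 1 / ((m : ℝ) + 1) < seqRatio η i} with hB
    have hmono : Monotone B := fun m m' hm η hη i hi =>
      lt_of_le_of_lt (by gcongr) (hη i hi)
    have h := eventually_measureReal_iUnion_le (Q := chiSqSeq) hmono
      (x := fun n => (P n).real {ω | IsSiegelReduced s (fun i => b n i ω)}) (fun m δ hδ => by
        filter_upwards [eventually_le_measureReal_isSiegelReduced hν hconc
          (t := s ^ 2 + 1 / ((m : ℝ) + 1)) (by positivity)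
          (lt_add_of_pos_right _ (by positivity)) hδ, eventually_ge_atTop g] with n hn hgn
        have h1 := hn (n - g) (Nat.sub_le _ _) (Ω n) (P n) (b n) (hb n)
        rwa [Nat.sub_sub_self hgn] at h1) hδ
    have hle : c ≤ chiSqSeq.real (⋃ m, B m) := by
      refine ENNReal.toReal_mono (measure_ne_top _ _) (measure_mono_ae ?_)
      filter_upwards [ae_seqRatio_tendsto] with η hlim hη
      obtain ⟨v, hv, hv1⟩ := exists_between hs2
      obtain ⟨K, hK⟩ := eventually_atTop.1 (hlim.eventually (lt_mem_nhds hv1))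
      have hlim0 : Tendsto (fun m : ℕ => s ^ 2 + 1 / ((m : ℝ) + 1)) atTop (𝓝 (s ^ 2)) := by
        simpa using tendsto_one_div_add_atTop_nhds_zero_nat.const_add (s ^ 2)
      have hfin : ∀ᶠ m : ℕ in atTop, ∀ i ∈ Finset.Icc g K,
          s ^ 2 + 1 / ((m : ℝ) + 1) < seqRatio η i := by
        rw [Filter.eventually_all_finset]
        exact fun i hi => hlim0.eventually (gt_mem_nhds (hη i (Finset.mem_Icc.1 hi).1))
      obtain ⟨m, h1, h2⟩ := (hfin.and (hlim0.eventually (gt_mem_nhds hv))).exists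
      refine Set.mem_iUnion.2 ⟨m, fun i hi => ?_⟩
      by_cases h : i ≤ K
      · exact h1 i (Finset.mem_Icc.2 ⟨hi, h⟩)
      · exact h2.trans (hK i (not_le.1 h).le)
    filter_upwards [h] with n hn using hle.trans hn
  -- The same argument is applied to the complement. A failing ratio is almost surely strictly below
  -- `s ^ 2`, since equality has probability 0.
  have hupp : ∀ δ > 0, ∀ᶠ n in atTop,
      1 - c ≤ (1 - (P n).real {ω | IsSiegelReduced s (fun i => b n i ω)}) + δ := by
    intro δ hδ
    set B : ℕ → Set (ℕ → ℝ) := fun m =>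
      {η | ∃ i, g ≤ i ∧ i ≤ m ∧ seqRatio η i < s ^ 2 - 1 / ((m : ℝ) + 1)} with hB
    have hmono : Monotone B := by
      rintro m m' hm η ⟨i, h1, h2, h3⟩
      exact ⟨i, h1, h2.trans hm, h3.trans_le (by gcongr)⟩
    have h := eventually_measureReal_iUnion_le (Q := chiSqSeq) hmono
      (x := fun n => 1 - (P n).real {ω | IsSiegelReduced s (fun i => b n i ω)}) (fun m δ hδ => by
        filter_upwards [eventually_le_measureReal_not_isSiegelReduced hν hconc
          (t := s ^ 2 - 1 / ((m : ℝ) + 1)) hs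
          (sub_lt_self _ (by positivity)) hδ, eventually_ge_atTop g, eventually_ge_atTop (m + 2)]
          with n hn hgn hmn
        have h1 := hn (n - g) (Nat.sub_le _ _) (Ω n) (P n) (b n) (hb n)
        have h2 : NullMeasurableSet {ω | IsSiegelReduced s (fun i => b n i ω)} (P n) :=
          (hb n).aemeasurable.nullMeasurableSet_preimage (measurableSet_isSiegelReduced s)
        have h3 : (P n).real {ω | ¬ IsSiegelReduced s (fun i => b n i ω)}
            = 1 - (P n).real {ω | IsSiegelReduced s (fun i => b n i ω)} :=
          probReal_compl_eq_one_sub₀ h2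
        rw [h3, Nat.sub_sub_self hgn] at h1
        refine le_trans (measureReal_mono ?_) h1
        rintro η ⟨i, hi1, hi2, hi3⟩
        exact ⟨i, hi1, by omega, hi3⟩) hδ
    have hle : 1 - c ≤ chiSqSeq.real (⋃ m, B m) := by
      rw [hc, ← probReal_compl_eq_one_sub (measurableSet_seqRatio_gt _ _)]
      refine ENNReal.toReal_mono (measure_ne_top _ _) (measure_mono_ae ?_)
      filter_upwards [ae_all_iff.2 fun i => ae_seqRatio_ne_const i (s ^ 2)] with η hne hη
      have hη' : ¬ ∀ i, g ≤ i → s ^ 2 < seqRatio η i := hη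
      push Not at hη'
      obtain ⟨i, hi, hle⟩ := hη'
      have hlt := lt_of_le_of_ne hle (hne i)
      have hlim0 : Tendsto (fun m : ℕ => s ^ 2 - 1 / ((m : ℝ) + 1)) atTop (𝓝 (s ^ 2)) := by
        simpa using tendsto_one_div_add_atTop_nhds_zero_nat.const_sub (s ^ 2)
      obtain ⟨m, h1, h2⟩ := ((hlim0.eventually (lt_mem_nhds hlt)).and
        (eventually_ge_atTop i)).exists
      exact Set.mem_iUnion.2 ⟨m, i, hi, h2, h1⟩
    filter_upwards [h] with n hn using hle.trans hn
  refine tendsto_order.2 ⟨fun x hx => ?_, fun x hx => ?_⟩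
  · filter_upwards [hlow ((c - x) / 2) (by linarith)] with n hn
    linarith
  · filter_upwards [hupp ((x - c) / 2) (by linarith)] with n hn
    linarith

/-- The limit law of the index of worst local reduction in codimension `g`. -/
noncomputable def worstIndexLaw (g : ℕ) : ProbabilityMeasure ℕ :=
  ⟨chiSqSeq.map (seqWorstIndex g),
    Measure.isProbabilityMeasure_map (measurable_seqWorstIndex g).aemeasurable⟩

lemma eventually_worstIndexLaw_le (hν : IsSphericalModel ν)
    (hconc : RadialConcentration ν) {g : ℕ}
    {b : (n : ℕ) → Fin (n - g) → Ω n → EuclideanSpace ℝ (Fin n)}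
    (hb : ∀ n, IsRandomBasis (P n) (ν n) (b n)) (G : Set ℕ) {δ : ℝ} (hδ : 0 < δ) :
    ∀ᶠ n in atTop, (worstIndexLaw g : Measure ℕ).real G
      ≤ (P n).real {ω | worstIndex (fun i => b n i ω) ∈ G} + δ := by
  -- Positivity is built into the event because monotonicity in `m` needs positive ratios.
  set B : ℕ → Set (ℕ → ℝ) := fun m =>
    {η | (∀ k, 1 ≤ k → 0 < η k) ∧ ∃ k ∈ G, g ≤ k ∧ k ≤ m ∧ ∀ i, g ≤ i → i ≠ k →
      seqRatio η k < (1 - 1 / ((m : ℝ) + 1)) * seqRatio η i} with hB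
  have hratio : ∀ {η : ℕ → ℝ}, (∀ k, 1 ≤ k → 0 < η k) → ∀ i, 0 < seqRatio η i := fun h i =>
    div_pos (h _ (by omega)) (h _ (by omega))
  have hmono : Monotone B := by
    rintro m m' hm η ⟨h0, k, h1, h2, h3, h4⟩
    refine ⟨h0, k, h1, h2, h3.trans hm, fun i hi hik => (h4 i hi hik).trans_le ?_⟩
    have := hratio h0 i
    gcongr
  have h := eventually_measureReal_iUnion_le (Q := chiSqSeq) hmono
    (x := fun n => (P n).real {ω | worstIndex (fun i => b n i ω) ∈ G}) (fun m δ hδ => by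
      filter_upwards [eventually_le_measureReal_worstIndex hν hconc
        (t := 1 - 1 / ((m : ℝ) + 1)) (sub_lt_self _ (by positivity)) hδ G, eventually_ge_atTop g,
        eventually_ge_atTop (m + 2)] with n hn hgn hmn
      have h1 := hn (n - g) (Nat.sub_le _ _) (Ω n) (P n) (b n) (hb n)
      rw [Nat.sub_sub_self hgn] at h1
      refine le_trans (measureReal_mono ?_) h1
      rintro η ⟨-, k, hk1, hk2, hk3, hk4⟩
      exact ⟨k, hk1, hk2, by omega, hk4⟩) hδ
  have hle : (worstIndexLaw g : Measure ℕ).real G ≤ chiSqSeq.real (⋃ m, B m) := by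
    have hmap : (worstIndexLaw g : Measure ℕ).real G = chiSqSeq.real (seqWorstIndex g ⁻¹' G) :=
      map_measureReal_apply (measurable_seqWorstIndex g) (MeasurableSet.of_discrete)
    rw [hmap]
    refine ENNReal.toReal_mono (measure_ne_top _ _) (measure_mono_ae ?_)
    filter_upwards [ae_seqWorstIndex_gap g, ae_chiSqSeq_pos] with η hη hpos hG
    obtain ⟨h1, t, ht, h2⟩ := hη
    have hlim0 : Tendsto (fun m : ℕ => 1 - 1 / ((m : ℝ) + 1)) atTop (𝓝 1) := by
      simpa using tendsto_one_div_add_atTop_nhds_zero_nat.const_sub (1 : ℝ)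
    obtain ⟨m, h3, h4⟩ := ((hlim0.eventually (lt_mem_nhds ht)).and
      (eventually_ge_atTop (seqWorstIndex g η))).exists
    refine Set.mem_iUnion.2 ⟨m, hpos, _, hG, h1, h4, fun i hi hik => (h2 i hi hik).trans ?_⟩
    exact mul_lt_mul_of_pos_right h3 (hratio hpos i)
  filter_upwards [h] with n hn using hle.trans hn

lemma tendstoInDistribution_worstIndex (hν : IsSphericalModel ν)
    (hconc : RadialConcentration ν) {g : ℕ}
    {b : (n : ℕ) → Fin (n - g) → Ω n → EuclideanSpace ℝ (Fin n)}
    (hb : ∀ n, IsRandomBasis (P n) (ν n) (b n)) :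
    TendstoInDistribution (fun n ω => worstIndex (fun i => b n i ω)) atTop
      (id : ℕ → ℕ) P (worstIndexLaw g : Measure ℕ) := by
  have hmeas : ∀ n, AEMeasurable (fun ω => worstIndex (fun i => b n i ω)) (P n) := fun n =>
    measurable_worstIndex.comp_aemeasurable (hb n).aemeasurable
  -- By the portmanteau theorem, lower bounds on open sets are enough; the one used here holds for
  -- every set of integers.
  refine ⟨hmeas, aemeasurable_id, tendsto_of_forall_isOpen_le_liminf fun G _ => ?_⟩
  refine le_of_forall_lt fun y hy => ?_
  obtain ⟨z, hyz, hz⟩ := exists_between hy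
  refine hyz.trans_le (le_liminf_of_le
    (IsBoundedUnder.isCoboundedUnder_ge (isBoundedUnder_of ⟨1, fun n => ?_⟩)) ?_)
  · exact ProbabilityMeasure.apply_le_one _ _
  · have hz' : (z : ℝ) < ((worstIndexLaw g : Measure ℕ).map id).real G := NNReal.coe_lt_coe.2 hz
    rw [Measure.map_id] at hz'
    filter_upwards [eventually_worstIndexLaw_le hν hconc hb G (sub_pos.2 hz')] with n hn
    refine NNReal.coe_le_coe.1 ?_
    change (z : ℝ) ≤ ((P n).map fun ω => worstIndex (fun i => b n i ω)).real G
    rw [map_measureReal_apply_of_aemeasurable (hmeas n) MeasurableSet.of_discrete]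
    change (z : ℝ) ≤ (P n).real {ω | worstIndex (fun i => b n i ω) ∈ G}
    linarith

end

theorem theorem1p4 (s : ℝ) (hs : s ∈ Set.Ioo (0 : ℝ) 1) :
    -- (i) codimension tending to infinity
    (∀ (ν : (n : ℕ) → Measure (EuclideanSpace ℝ (Fin n))),
      IsSphericalModel ν → RadialConcentration ν →
      ∀ g : ℕ → ℕ, (∀ n, g n ≤ n) → Tendsto g atTop atTop →
      ∀ (Ω : ℕ → Type u) [∀ n, MeasurableSpace (Ω n)] (P : (n : ℕ) → Measure (Ω n))
        [∀ n, IsProbabilityMeasure (P n)]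
        (b : (n : ℕ) → Fin (n - g n) → Ω n → EuclideanSpace ℝ (Fin n)),
      (∀ n, IsRandomBasis (P n) (ν n) (b n)) →
      Tendsto (fun n => (P n).real {ω | IsSiegelReduced s (fun i => b n i ω)}) atTop (𝓝 1)) ∧
    -- (ii) constant codimension: the limit depends only on `s` and `g`
    (∀ g : ℕ, ∃ c ∈ Set.Ioo (0 : ℝ) 1,
      ∀ (ν : (n : ℕ) → Measure (EuclideanSpace ℝ (Fin n))),
      IsSphericalModel ν → RadialConcentration ν →
      ∀ (Ω : ℕ → Type u) [∀ n, MeasurableSpace (Ω n)] (P : (n : ℕ) → Measure (Ω n))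
        [∀ n, IsProbabilityMeasure (P n)]
        (b : (n : ℕ) → Fin (n - g) → Ω n → EuclideanSpace ℝ (Fin n)),
      (∀ n, IsRandomBasis (P n) (ν n) (b n)) →
      Tendsto (fun n => (P n).real {ω | IsSiegelReduced s (fun i => b n i ω)}) atTop (𝓝 c)) ∧
    -- (iii) constant codimension: convergence in distribution of the index of worst local
    -- reduction to a probability law on `ℕ` which depends only on `g`
    (∀ g : ℕ, ∃ L : ProbabilityMeasure ℕ,
      ∀ (ν : (n : ℕ) → Measure (EuclideanSpace ℝ (Fin n))),
      IsSphericalModel ν → RadialConcentration ν →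
      ∀ (Ω : ℕ → Type u) [∀ n, MeasurableSpace (Ω n)] (P : (n : ℕ) → Measure (Ω n))
        [∀ n, IsProbabilityMeasure (P n)]
        (b : (n : ℕ) → Fin (n - g) → Ω n → EuclideanSpace ℝ (Fin n)),
      (∀ n, IsRandomBasis (P n) (ν n) (b n)) →
      TendstoInDistribution (fun n ω => worstIndex (fun i => b n i ω)) atTop
        (id : ℕ → ℕ) P (L : Measure ℕ)) := by
  refine ⟨fun ν hν hconc g hgn hg Ω _ P _ b hb =>
      tendsto_measureReal_isSiegelReduced_one hν hconc hs hgn hg hb,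
    fun g => ⟨chiSqSeq.real {η | ∀ i, g ≤ i → s ^ 2 < seqRatio η i}, ⟨?_, ?_⟩,
      fun ν hν hconc Ω _ P _ b hb =>
        tendsto_measureReal_isSiegelReduced hν hconc hs.1 hs.2 hb⟩,
    fun g => ⟨worstIndexLaw g, fun ν hν hconc Ω _ P _ b hb =>
      tendstoInDistribution_worstIndex hν hconc hb⟩⟩
  · exact measureReal_seqRatio_gt_pos (pow_pos hs.1 2) (by nlinarith [hs.1, hs.2]) g
  · exact measureReal_seqRatio_gt_lt_one (pow_pos hs.1 2) g
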